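/- Write $C^\infty$ for smooth in the usual sense (for maps on convex subsets $C\subseteq\mathbb R^n$: smooth along $C$, boundary points included). All spaces below have underlying sets, and composition of morphisms is composition of maps. \begin{itemize} \item A \emph{Chen space} is a set $X$ with a family of maps into $X$, called plots, whose domains are convex subsets of Euclidean spaces $\mathbb R^n$, $n\ge 0$, such that: every constant map on a convex set is a plot; if $\phi\colon C\to X$ is a plot and $\theta\colon C'\to C$ is a $C^\infty$-map between convex sets, then $\phi\theta$ is a plot; a map $C\to X$ on a convex set which is everywhere locally a plot (that is, each point of $C$ has a convex relative neighbourhood in $C$ on which the map is a plot) is a plot. A \emph{Souriau space} (diffeological space) is defined in the same way with open subsets of Euclidean spaces in place of convex ones. Morphisms of Chen spaces, and of Souriau spaces, are the maps that take plots to plots. \item A \emph{Fr\"olicher space} is a set $X$ with a set $\mathcal C$ of maps $\mathbb R\to X$ and a set $\mathcal F$ of maps $X\to\mathbb R$ such that $c\in\mathcal C$ if and only if $fc\in C^\infty(\mathbb R,\mathbb R)$ for all $f\in\mathcal F$, and $f\in\mathcal F$ if and only if $fc\in C^\infty(\mathbb R,\mathbb R)$ for all $c\in\mathcal C$. Morphisms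 are the maps $\phi\colon X\to Y$ with $\phi c\in\mathcal C_Y$ for all $c\in\mathcal C_X$. \item A \emph{Sikorski space} is a topological space $X$ with a unital subalgebra $\mathcal F$ of the algebra of continuous functions $X\to\mathbb R$ such that: a function $f\colon X\to\mathbb R$ that agrees in a neighbourhood of each point with some element of $\mathcal F$ is in $\mathcal F$; and $g(f_1,\dots,f_k)\in\mathcal F$ whenever $f_1,\dots,f_k\in\mathcal F$ and $g\in C^\infty(\mathbb R^k,\mathbb R)$. \item A \emph{Smith space} is a topological space $X$ with a set $\mathcal F$ of continuous functions $X\to\mathbb R$ that contains every continuous $g\colon X\to\mathbb R$ with the following property: $g\phi\in C^\infty(U,\mathbb R)$ for all $n$, all open $U\subseteq\mathbb R^n$ and all continuous $\phi\colon U\to X$ such that $f\phi\in C^\infty(U,\mathbb R)$ for every $f\in\mathcal F$. \item Morphisms of Sikorski spaces, and of Smith spaces, are the continuous maps $\phi\colon X\to Y$ with $f\phi\in\mathcal F_X$ for all $f\in\mathcal F_Y$. \end{itemize} Then no two of the categories of Chen spaces, Souriau spaces and Fr\"olicher spaces are equivalent as categories, and no two of the categories of Sikorski spaces, Smith spaces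 and Fr\"olicher spaces are equivalent as categories. -/

import Mathlib

universe u

open CategoryTheory Topology
open scoped ContDiff

namespace SmoothSpaces

/-- The Euclidean space `ℝⁿ`. -/
abbrev Euc (n : ℕ) : Type := EuclideanSpace ℝ (Fin n)

/-! ### Chen spaces -/

/-- A Chen space: a set with a family of plots, whose domains are the convex subsets of Euclidean
spaces (of any dimension).  A smooth map between convex sets is written as a total map that is
smooth on the domain (`ContDiffOn ℝ ∞`) and maps the domain into the target. -/
structure ChenSpace : Type (u + 1) where
  /-- the underlying set -/
  carrier : Type u
  /-- the plots with a given domain -/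
  IsPlot : ∀ {n : ℕ} (C : Set (Euc n)), (C → carrier) → Prop
  convex_of_isPlot : ∀ {n : ℕ} {C : Set (Euc n)} {φ : C → carrier}, IsPlot C φ → Convex ℝ C
  /-- every constant map is a plot -/
  isPlot_const : ∀ {n : ℕ} {C : Set (Euc n)}, Convex ℝ C → ∀ x : carrier, IsPlot C (fun _ => x)
  /-- plots are stable under precomposition with smooth maps between convex sets -/
  isPlot_comp : ∀ {n m : ℕ} {C : Set (Euc n)} {C' : Set (Euc m)} {φ : C → carrier}
    {θ : Euc m → Euc n}, IsPlot C φ → Convex ℝ C' → ContDiffOn ℝ ∞ θ C' →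
    ∀ h : Set.MapsTo θ C' C, IsPlot C' (φ ∘ h.restrict θ C' C)
  /-- a map on a convex set that is everywhere locally a plot is a plot -/
  isPlot_of_local : ∀ {n : ℕ} {C : Set (Euc n)} {φ : C → carrier}, Convex ℝ C →
    (∀ x ∈ C, ∃ (V : Set (Euc n)) (hV : V ⊆ C), V ∈ 𝓝[C] x ∧ Convex ℝ V ∧
      IsPlot V (φ ∘ Set.inclusion hV)) →
    IsPlot C φ

/-- A map of Chen spaces is a map of the underlying sets that takes plots to plots. -/
def ChenSpace.IsMorphism (X Y : ChenSpace.{u}) (f : X.carrier → Y.carrier) : Prop :=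
  ∀ {n : ℕ} (C : Set (Euc n)) (φ : C → X.carrier), X.IsPlot C φ → Y.IsPlot C (f ∘ φ)

instance ChenSpace.category : Category.{u} ChenSpace.{u} where
  Hom X Y := {f : X.carrier → Y.carrier // ChenSpace.IsMorphism X Y f}
  id _ := ⟨id, fun _ _ h => h⟩
  comp f g := ⟨g.1 ∘ f.1, fun C φ h => g.2 C (f.1 ∘ φ) (f.2 C φ h)⟩

/-! ### Souriau spaces (diffeological spaces) -/

/-- A Souriau space: a set with a family of plots, whose domains are the open subsets of Euclidean
spaces (of any dimension). -/
structure SouriauSpace : Type (u + 1) where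
  /-- the underlying set -/
  carrier : Type u
  /-- the plots with a given domain -/
  IsPlot : ∀ {n : ℕ} (U : Set (Euc n)), (U → carrier) → Prop
  isOpen_of_isPlot : ∀ {n : ℕ} {U : Set (Euc n)} {φ : U → carrier}, IsPlot U φ → IsOpen U
  /-- every constant map is a plot -/
  isPlot_const : ∀ {n : ℕ} {U : Set (Euc n)}, IsOpen U → ∀ x : carrier, IsPlot U (fun _ => x)
  /-- plots are stable under precomposition with smooth maps between open sets -/
  isPlot_comp : ∀ {n m : ℕ} {U : Set (Euc n)} {U' : Set (Euc m)} {φ : U → carrier}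
    {θ : Euc m → Euc n}, IsPlot U φ → IsOpen U' → ContDiffOn ℝ ∞ θ U' →
    ∀ h : Set.MapsTo θ U' U, IsPlot U' (φ ∘ h.restrict θ U' U)
  /-- a map on an open set that is everywhere locally a plot is a plot -/
  isPlot_of_local : ∀ {n : ℕ} {U : Set (Euc n)} {φ : U → carrier}, IsOpen U →
    (∀ x ∈ U, ∃ (V : Set (Euc n)) (hV : V ⊆ U), x ∈ V ∧ IsOpen V ∧
      IsPlot V (φ ∘ Set.inclusion hV)) →
    IsPlot U φ

/-- A map of Souriau spaces is a map of the underlying sets that takes plots to plots. -/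
def SouriauSpace.IsMorphism (X Y : SouriauSpace.{u}) (f : X.carrier → Y.carrier) : Prop :=
  ∀ {n : ℕ} (U : Set (Euc n)) (φ : U → X.carrier), X.IsPlot U φ → Y.IsPlot U (f ∘ φ)

instance SouriauSpace.category : Category.{u} SouriauSpace.{u} where
  Hom X Y := {f : X.carrier → Y.carrier // SouriauSpace.IsMorphism X Y f}
  id _ := ⟨id, fun _ _ h => h⟩
  comp f g := ⟨g.1 ∘ f.1, fun U φ h => g.2 U (f.1 ∘ φ) (f.2 U φ h)⟩

/-! ### Frölicher spaces -/

/-- A Frölicher space: a set with a family of curves and a family of functionals that determine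
each other. -/
structure FrolicherSpace : Type (u + 1) where
  /-- the underlying set -/
  carrier : Type u
  /-- the smooth curves -/
  curves : Set (ℝ → carrier)
  /-- the smooth functionals -/
  functionals : Set (carrier → ℝ)
  mem_curves_iff : ∀ c : ℝ → carrier, c ∈ curves ↔ ∀ f ∈ functionals, ContDiff ℝ ∞ (f ∘ c)
  mem_functionals_iff : ∀ f : carrier → ℝ, f ∈ functionals ↔ ∀ c ∈ curves, ContDiff ℝ ∞ (f ∘ c)

/-- A map of Frölicher spaces is a map of the underlying sets that takes curves to curves. -/
def FrolicherSpace.IsMorphism (X Y : FrolicherSpace.{u}) (φ : X.carrier → Y.carrier) : Prop :=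
  ∀ c ∈ X.curves, φ ∘ c ∈ Y.curves

instance FrolicherSpace.category : Category.{u} FrolicherSpace.{u} where
  Hom X Y := {φ : X.carrier → Y.carrier // FrolicherSpace.IsMorphism X Y φ}
  id _ := ⟨id, fun _ h => h⟩
  comp f g := ⟨g.1 ∘ f.1, fun c h => g.2 (f.1 ∘ c) (f.2 c h)⟩

/-! ### Sikorski spaces -/

/-- A Sikorski space: a topological space with a (unital) subalgebra of the algebra of continuous
real-valued functions that is locally detectable and closed under smooth operations. -/
structure SikorskiSpace : Type (u + 1) where
  /-- the underlying set -/
  carrier : Type u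
  /-- the topology -/
  top : TopologicalSpace carrier
  /-- the smooth functions -/
  functions : Subalgebra ℝ (carrier → ℝ)
  continuous_of_mem : ∀ f ∈ functions, Continuous f
  /-- a function that agrees with a smooth function near each point is smooth -/
  mem_of_local : ∀ f : carrier → ℝ,
    (∀ x, ∃ V ∈ 𝓝 x, ∃ g ∈ functions, Set.EqOn f g V) → f ∈ functions
  /-- smooth functions of finitely many smooth functions are smooth -/
  smooth_comp_mem : ∀ (k : ℕ) (f : Fin k → carrier → ℝ) (g : Euc k → ℝ),
    (∀ i, f i ∈ functions) → ContDiff ℝ ∞ g →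
    (fun x => g (WithLp.toLp 2 fun i => f i x)) ∈ functions

attribute [instance] SikorskiSpace.top

/-- A map of Sikorski spaces is a continuous map along which smooth functions pull back to smooth
functions. -/
def SikorskiSpace.IsMorphism (X Y : SikorskiSpace.{u}) (φ : X.carrier → Y.carrier) : Prop :=
  Continuous φ ∧ ∀ f ∈ Y.functions, f ∘ φ ∈ X.functions

instance SikorskiSpace.category : Category.{u} SikorskiSpace.{u} where
  Hom X Y := {φ : X.carrier → Y.carrier // SikorskiSpace.IsMorphism X Y φ}
  id _ := ⟨id, continuous_id, fun _ h => h⟩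
  comp φ ψ := ⟨ψ.1 ∘ φ.1, ψ.2.1.comp φ.2.1, fun f h => φ.2.2 (f ∘ ψ.1) (ψ.2.2 f h)⟩

/-! ### Smith spaces -/

/-- A real-valued function on a subset `U` of `ℝⁿ` is smooth. -/
def IsSmoothFun {n : ℕ} (U : Set (Euc n)) (h : U → ℝ) : Prop :=
  ∃ g : Euc n → ℝ, ContDiffOn ℝ ∞ g U ∧ ∀ x : U, g x = h x

/-- The continuous maps `U → X` along which all functions of the family `F` pull back to smooth
functions. -/
def smithPlots {X : Type u} [TopologicalSpace X] (F : Set (X → ℝ)) {n : ℕ} (U : Set (Euc n)) :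
    Set (U → X) :=
  {φ | Continuous φ ∧ ∀ f ∈ F, IsSmoothFun U (f ∘ φ)}

/-- A Smith space: a topological space with a set of continuous real-valued functions that contains
every continuous function that is smooth along all the maps of `smithPlots` with open domain. -/
structure SmithSpace : Type (u + 1) where
  /-- the underlying set -/
  carrier : Type u
  /-- the topology -/
  top : TopologicalSpace carrier
  /-- the smooth functions -/
  functions : Set (carrier → ℝ)
  continuous_of_mem : ∀ f ∈ functions, Continuous f
  /-- the closure condition -/
  mem_of_smooth : ∀ g : carrier → ℝ, Continuous g →
    (∀ (n : ℕ) (U : Set (Euc n)), IsOpen U → ∀ φ ∈ smithPlots functions U,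
      IsSmoothFun U (g ∘ φ)) →
    g ∈ functions

attribute [instance] SmithSpace.top

/-- A map of Smith spaces is a continuous map along which smooth functions pull back to smooth
functions. -/
def SmithSpace.IsMorphism (X Y : SmithSpace.{u}) (φ : X.carrier → Y.carrier) : Prop :=
  Continuous φ ∧ ∀ f ∈ Y.functions, f ∘ φ ∈ X.functions

instance SmithSpace.category : Category.{u} SmithSpace.{u} where
  Hom X Y := {φ : X.carrier → Y.carrier // SmithSpace.IsMorphism X Y φ}
  id _ := ⟨id, continuous_id, fun _ h => h⟩
  comp φ ψ := ⟨ψ.1 ∘ φ.1, ψ.2.1.comp φ.2.1, fun f h => φ.2.2 (f ∘ ψ.1) (ψ.2.2 f h)⟩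

end SmoothSpaces

/-!
The points of a space in each of the five categories are the morphisms from a one-point space, which
is terminal.  An equivalence therefore induces bijections on underlying sets, and a map of sets is
a morphism on one side if and only if its conjugate is one on the other (`exists_correspondence`).
It remains to tell the categories apart by properties of maps of sets.

*Frölicher spaces.*  The two points of a two-point Frölicher space can be exchanged by a morphism,
because a function on two points is carried by the exchange to a constant minus itself.  In the
other four categories this fails for the Sierpinski space, with all continuous maps to it as plots,
or with all continuous functions on it as smooth functions (`isEmpty_equivalence_frolicher`).

*Sikorski and Smith spaces.*  A two-point Smith space whose points cannot be exchanged is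
a Sierpinski space, so an equivalence preserves continuity of maps, and it preserves clopen sets.
A Smith space whose clopen sets separate points has only locally constant test maps, so all
continuous functions on it are smooth.  For Sikorski spaces this fails: the identity from the
rationals with locally constant functions to the rationals with continuous functions is continuous
but not a morphism (`isEmpty_equivalence_sikorski_smith`).

*Chen and Souriau spaces.*  Let `G` be a Chen space that corresponds to the Souriau space of reals.
Its endomorphisms are the smooth functions, and neither `G` nor the Souriau space corresponding to
the Chen space of reals is discrete; so there are nonconstant morphisms in both directions between
`G` and the Chen space of reals.  With an affine function inserted between them they compose to
a nonconstant smooth endomorphism of `G`.  This is an embedding on a small interval, and an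
embedding of `G` in the Chen space of reals results (`ChenSpace.exists_embedding`).  Its range is
an interval as `G` is connected by curves, and it has no endpoints as `G` is homogeneous.  Hence the
Chen spaces that correspond to the `ℝⁿ` are open cubes in `ℝⁿ`, so a Souriau morphism can be
tested, on the Chen side, on plots with open domain.  But a Chen morphism cannot: the
half-line has a proper substructure with the same plots on open domains, given by the functions
whose derivative vanishes where they do (`ChenSpace.flatHalfLine`).
-/

namespace SmoothSpaces

/-! ### Equivalences and underlying sets -/

/-- A category whose objects have underlying sets and whose morphisms are maps of these, such that
constant maps are morphisms and some object has exactly one point. -/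
class PointCategory (C : Type (u + 1)) [Category.{u} C] where
  /-- the underlying set of an object -/
  pts : C → Type u
  /-- the underlying map of a morphism -/
  toMap : ∀ {X Y : C}, (X ⟶ Y) → pts X → pts Y
  toMap_injective : ∀ {X Y : C} {f g : X ⟶ Y}, toMap f = toMap g → f = g
  toMap_id : ∀ X : C, toMap (𝟙 X) = id
  toMap_comp : ∀ {X Y Z : C} (f : X ⟶ Y) (g : Y ⟶ Z), toMap (f ≫ g) = toMap g ∘ toMap f
  exists_const : ∀ (X Y : C) (y : pts Y), ∃ f : X ⟶ Y, toMap f = fun _ => y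
  exists_point : ∃ P : C, ∃ p : pts P, ∀ q, q = p

namespace PointCategory

variable {C : Type (u + 1)} [Category.{u} C] [PointCategory C]
variable {D : Type (u + 1)} [Category.{u} D] [PointCategory D]

/-- A map of underlying sets is a morphism. -/
def IsMor (X Y : C) (f : pts X → pts Y) : Prop :=
  ∃ g : X ⟶ Y, toMap g = f

theorem IsMor.comp {X Y Z : C} {g : pts Y → pts Z} {f : pts X → pts Y} (hg : IsMor Y Z g)
    (hf : IsMor X Y f) : IsMor X Z (g ∘ f) := by
  obtain ⟨f, rfl⟩ := hf
  obtain ⟨g, rfl⟩ := hg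
  exact ⟨f ≫ g, toMap_comp f g⟩

/-- The morphisms out of an object with exactly one point are the points of the target. -/
noncomputable def pointEquiv {P : C} (p : pts P) (hp : ∀ q, q = p) (X : C) : (P ⟶ X) ≃ pts X where
  toFun f := toMap f p
  invFun x := (exists_const P X x).choose
  left_inv f := toMap_injective <| by
    rw [(exists_const P X (toMap f p)).choose_spec]
    funext q
    rw [hp q]
  right_inv x := congrFun (exists_const P X x).choose_spec p

/-- An equivalence takes one-point objects to one-point objects: these are the terminal objects. -/
theorem exists_point_functor (e : C ≌ D) {P : C} {p : pts P} (hp : ∀ q, q = p) :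
    ∃ p' : pts (e.functor.obj P), ∀ q, q = p' := by
  obtain ⟨Q, q, hq⟩ := exists_point (C := D)
  let E : (Q ⟶ e.functor.obj P) ≃ (e.inverse.obj Q ⟶ P) :=
    (e.symm.toAdjunction.homEquiv Q P).symm
  obtain ⟨k, -⟩ := exists_const (e.inverse.obj Q) P p
  refine ⟨toMap (E.symm k) q, fun r => ?_⟩
  obtain ⟨f, hf⟩ := exists_const Q (e.functor.obj P) r
  have : f = E.symm k := by
    rw [Equiv.eq_symm_apply]
    refine toMap_injective (funext fun x => ?_)
    rw [hp (toMap (E f) x), hp (toMap k x)]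
  rw [← this, hf]

/-- An equivalence of categories induces bijections on underlying sets, and these identify the
morphisms of the two categories.  This is recorded as a relation between the objects of the two
categories, so that every object on either side has a partner. -/
theorem exists_correspondence (e : C ≌ D) :
    ∃ R : ∀ (X : C) (Y : D), (pts X ≃ pts Y) → Prop,
      (∀ X, ∃ Y β, R X Y β) ∧ (∀ Y, ∃ X β, R X Y β) ∧
      ∀ {X Y β X' Y' β'}, R X Y β → R X' Y' β' → ∀ f : pts X → pts X',
        IsMor X X' f ↔ IsMor Y Y' (β' ∘ f ∘ β.symm) := by
  obtain ⟨P, p, hp⟩ := exists_point (C := C)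
  obtain ⟨p', hp'⟩ := exists_point_functor e hp
  let F := e.functor
  let b (X : C) : pts X ≃ pts (F.obj X) :=
    (pointEquiv p hp X).symm.trans
      ((Functor.FullyFaithful.ofFullyFaithful F).homEquiv.trans (pointEquiv p' hp' (F.obj X)))
  have hb {X X' : C} (g : X ⟶ X') (x : pts X) : toMap (F.map g) (b X x) = b X' (toMap g x) := by
    obtain ⟨k, rfl⟩ := (pointEquiv p hp X).surjective x
    have h1 : toMap g (pointEquiv p hp X k) = pointEquiv p hp X' (k ≫ g) := by
      simp [pointEquiv, toMap_comp]
    rw [h1]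
    simp only [b, Equiv.trans_apply, Equiv.symm_apply_apply]
    simp [pointEquiv, toMap_comp, Functor.FullyFaithful.homEquiv]
  have hinv {Y Y' : D} (i : Y ≅ Y') (y : pts Y) : toMap i.inv (toMap i.hom y) = y := by
    rw [← Function.comp_apply (f := toMap i.inv), ← toMap_comp, i.hom_inv_id, toMap_id, id]
  have hinv' {Y Y' : D} (i : Y ≅ Y') (y : pts Y') : toMap i.hom (toMap i.inv y) = y :=
    hinv i.symm y
  let t {Y Y' : D} (i : Y ≅ Y') : pts Y ≃ pts Y' :=
    ⟨toMap i.hom, toMap i.inv, hinv i, hinv' i⟩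
  refine ⟨fun X Y β => ∃ i : F.obj X ≅ Y, ∀ x, β x = toMap i.hom (b X x), fun X => ?_,
    fun Y => ?_, ?_⟩
  · exact ⟨F.obj X, b X, Iso.refl _, fun x => by simp [toMap_id]⟩
  · let i := e.counitIso.app Y
    exact ⟨e.inverse.obj Y, (b _).trans (t i), i, fun x => rfl⟩
  · rintro X Y β X' Y' β' ⟨i, hi⟩ ⟨i', hi'⟩ f
    constructor
    · rintro ⟨g, rfl⟩
      refine ⟨i.inv ≫ F.map g ≫ i'.hom, funext fun y => ?_⟩
      obtain ⟨x, rfl⟩ := β.surjective y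
      simp only [toMap_comp, Function.comp_apply, Equiv.symm_apply_apply]
      rw [hi, hi', hinv, hb]
    · rintro ⟨h, hh⟩
      refine ⟨F.preimage (i.hom ≫ h ≫ i'.inv), funext fun x => ?_⟩
      apply (b X').injective
      rw [← hb, F.map_preimage]
      have := congrFun hh (β x)
      simp only [Function.comp_apply, Equiv.symm_apply_apply] at this
      rw [hi, hi'] at this
      simp [toMap_comp, this, hinv]

end PointCategory

open PointCategory

/-! ### The five categories -/

instance : PointCategory ChenSpace.{u} where
  pts := ChenSpace.carrier
  toMap f := f.1
  toMap_injective h := Subtype.ext h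
  toMap_id _ := rfl
  toMap_comp _ _ := rfl
  exists_const X Y y :=
    ⟨⟨fun _ => y, fun _ _ h => Y.isPlot_const (X.convex_of_isPlot h) y⟩, rfl⟩
  exists_point :=
    ⟨{ carrier := PUnit
       IsPlot := fun C _ => Convex ℝ C
       convex_of_isPlot := id
       isPlot_const := fun h _ => h
       isPlot_comp := fun _ h _ _ => h
       isPlot_of_local := fun h _ => h }, PUnit.unit, fun _ => rfl⟩

instance : PointCategory SouriauSpace.{u} where
  pts := SouriauSpace.carrier
  toMap f := f.1
  toMap_injective h := Subtype.ext h
  toMap_id _ := rfl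
  toMap_comp _ _ := rfl
  exists_const X Y y :=
    ⟨⟨fun _ => y, fun _ _ h => Y.isPlot_const (X.isOpen_of_isPlot h) y⟩, rfl⟩
  exists_point :=
    ⟨{ carrier := PUnit
       IsPlot := fun U _ => IsOpen U
       isOpen_of_isPlot := id
       isPlot_const := fun h _ => h
       isPlot_comp := fun _ h _ _ => h
       isPlot_of_local := fun h _ => h }, PUnit.unit, fun _ => rfl⟩

instance : PointCategory FrolicherSpace.{u} where
  pts := FrolicherSpace.carrier
  toMap f := f.1
  toMap_injective h := Subtype.ext h
  toMap_id _ := rfl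
  toMap_comp _ _ := rfl
  exists_const _ Y y :=
    ⟨⟨fun _ => y, fun _ _ => (Y.mem_curves_iff _).2 fun f _ =>
      (contDiff_const : ContDiff ℝ ∞ fun _ : ℝ => f y)⟩, rfl⟩
  exists_point :=
    ⟨{ carrier := PUnit
       curves := Set.univ
       functionals := Set.univ
       mem_curves_iff := fun _ => ⟨fun _ f _ =>
         (contDiff_const : ContDiff ℝ ∞ fun _ : ℝ => f PUnit.unit), fun _ => trivial⟩
       mem_functionals_iff := fun f => ⟨fun _ _ _ =>
         (contDiff_const : ContDiff ℝ ∞ fun _ : ℝ => f PUnit.unit), fun _ => trivial⟩ },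
      PUnit.unit, fun _ => rfl⟩

instance : PointCategory SikorskiSpace.{u} where
  pts := SikorskiSpace.carrier
  toMap f := f.1
  toMap_injective h := Subtype.ext h
  toMap_id _ := rfl
  toMap_comp _ _ := rfl
  exists_const X _ y :=
    ⟨⟨fun _ => y, continuous_const, fun f _ => X.functions.algebraMap_mem (f y)⟩, rfl⟩
  exists_point :=
    ⟨{ carrier := PUnit
       top := inferInstance
       functions := ⊤
       continuous_of_mem := fun _ _ => continuous_of_const fun _ _ => rfl
       mem_of_local := fun _ _ => trivial
       smooth_comp_mem := fun _ _ _ _ _ => trivial }, PUnit.unit, fun _ => rfl⟩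

instance : PointCategory SmithSpace.{u} where
  pts := SmithSpace.carrier
  toMap f := f.1
  toMap_injective h := Subtype.ext h
  toMap_id _ := rfl
  toMap_comp _ _ := rfl
  exists_const X _ y :=
    ⟨⟨fun _ => y, continuous_const, fun f _ => X.mem_of_smooth _ continuous_const
      fun _ _ _ _ _ => ⟨fun _ => f y, contDiffOn_const, fun _ => rfl⟩⟩, rfl⟩
  exists_point :=
    ⟨{ carrier := PUnit
       top := inferInstance
       functions := Set.univ
       continuous_of_mem := fun _ _ => continuous_of_const fun _ _ => rfl
       mem_of_smooth := fun _ _ _ => trivial }, PUnit.unit, fun _ => rfl⟩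

theorem ChenSpace.isMor_iff {X Y : ChenSpace.{u}} {f : X.carrier → Y.carrier} :
    IsMor X Y f ↔ ChenSpace.IsMorphism X Y f :=
  ⟨fun ⟨g, h⟩ => h ▸ g.2, fun h => ⟨⟨f, h⟩, rfl⟩⟩

theorem SouriauSpace.isMor_iff {X Y : SouriauSpace.{u}} {f : X.carrier → Y.carrier} :
    IsMor X Y f ↔ SouriauSpace.IsMorphism X Y f :=
  ⟨fun ⟨g, h⟩ => h ▸ g.2, fun h => ⟨⟨f, h⟩, rfl⟩⟩

theorem FrolicherSpace.isMor_iff {X Y : FrolicherSpace.{u}} {f : X.carrier → Y.carrier} :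
    IsMor X Y f ↔ FrolicherSpace.IsMorphism X Y f :=
  ⟨fun ⟨g, h⟩ => h ▸ g.2, fun h => ⟨⟨f, h⟩, rfl⟩⟩

theorem SikorskiSpace.isMor_iff {X Y : SikorskiSpace.{u}} {f : X.carrier → Y.carrier} :
    IsMor X Y f ↔ SikorskiSpace.IsMorphism X Y f :=
  ⟨fun ⟨g, h⟩ => h ▸ g.2, fun h => ⟨⟨f, h⟩, rfl⟩⟩

theorem SmithSpace.isMor_iff {X Y : SmithSpace.{u}} {f : X.carrier → Y.carrier} :
    IsMor X Y f ↔ SmithSpace.IsMorphism X Y f :=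
  ⟨fun ⟨g, h⟩ => h ▸ g.2, fun h => ⟨⟨f, h⟩, rfl⟩⟩

/-! ### Sierpinski spaces and the exchange of two points -/

/-- The exchange of the two truth values. -/
def swapProp : ULift.{u} Prop → ULift.{u} Prop :=
  fun x => ⟨¬x.down⟩

theorem not_continuous_swapProp : ¬Continuous swapProp.{u} := by
  intro h
  have h1 : Continuous fun p : Prop => ¬p :=
    (continuous_uliftDown.comp h).comp continuous_uliftUp
  rw [continuous_Prop] at h1
  -- `False` would have a neighbourhood without `True`
  have h3 : (nhds False) = ⊤ := nhds_false
  have h4 : {p : Prop | ¬p} ∈ nhds False := h1.mem_nhds (by simp)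
  rw [h3, Filter.mem_top] at h4
  have : True ∈ {p : Prop | ¬p} := h4 ▸ trivial
  exact this trivial

/-- Continuity of a map on a subset of a Euclidean space can be checked locally. -/
theorem continuous_of_local {E X : Type*} [TopologicalSpace E] [TopologicalSpace X] {C : Set E}
    {φ : C → X} (h : ∀ x ∈ C, ∃ (V : Set E) (hV : V ⊆ C), V ∈ 𝓝[C] x ∧
      Continuous (φ ∘ Set.inclusion hV)) : Continuous φ := by
  rw [continuous_iff_continuousAt]
  rintro ⟨x, hx⟩
  obtain ⟨V, hV, hVx, hc⟩ := h x hx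
  have hW : ((↑) : C → E) ⁻¹' V ∈ 𝓝 (⟨x, hx⟩ : C) := by
    rw [nhds_subtype_eq_comap_nhdsWithin]
    exact Filter.preimage_mem_comap hVx
  refine ContinuousOn.continuousAt (s := ((↑) : C → E) ⁻¹' V) ?_ hW
  rw [continuousOn_iff_continuous_domRestrict]
  exact hc.comp (f := fun y : ((↑) : C → E) ⁻¹' V => (⟨y.1.1, y.2⟩ : V)) (by fun_prop)

/-- A topological space as a Chen space: the plots are the continuous maps. -/
def ChenSpace.ofTop (X : Type u) [TopologicalSpace X] : ChenSpace.{u} where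
  carrier := X
  IsPlot C φ := Convex ℝ C ∧ Continuous φ
  convex_of_isPlot h := h.1
  isPlot_const h _ := ⟨h, continuous_const⟩
  isPlot_comp h h' hθ hm := ⟨h', h.2.comp (hθ.continuousOn.mapsToRestrict hm)⟩
  isPlot_of_local h hφ := ⟨h, continuous_of_local fun x hx =>
    let ⟨V, hV, hVx, _, hc⟩ := hφ x hx
    ⟨V, hV, hVx, hc.2⟩⟩

/-- A topological space as a Souriau space: the plots are the continuous maps. -/
def SouriauSpace.ofTop (X : Type u) [TopologicalSpace X] : SouriauSpace.{u} where
  carrier := X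
  IsPlot U φ := IsOpen U ∧ Continuous φ
  isOpen_of_isPlot h := h.1
  isPlot_const h _ := ⟨h, continuous_const⟩
  isPlot_comp h h' hθ hm := ⟨h', h.2.comp (hθ.continuousOn.mapsToRestrict hm)⟩
  isPlot_of_local h hφ := ⟨h, continuous_of_local fun x hx =>
    let ⟨V, hV, hVx, hVo, hc⟩ := hφ x hx
    ⟨V, hV, mem_nhdsWithin_of_mem_nhds (hVo.mem_nhds hVx), hc.2⟩⟩

/-- A topological space as a Sikorski space: all continuous functions are smooth. -/
def SikorskiSpace.ofTop (X : Type u) [t : TopologicalSpace X] : SikorskiSpace.{u} where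
  carrier := X
  top := t
  functions :=
    { carrier := {f | Continuous f}
      mul_mem' := fun h h' => Continuous.mul h h'
      add_mem' := fun h h' => Continuous.add h h'
      algebraMap_mem' := fun _ => continuous_const }
  continuous_of_mem _ h := h
  mem_of_local f hf := by
    refine continuous_iff_continuousAt.2 fun x => ?_
    obtain ⟨V, hV, g, hg, hfg⟩ := hf x
    exact (Continuous.continuousAt hg).congr (Filter.mem_of_superset hV fun y hy => (hfg hy).symm)
  smooth_comp_mem k f g hf hg :=
    hg.continuous.comp ((PiLp.continuous_toLp 2 _).comp (continuous_pi hf))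

/-- A topological space as a Smith space: all continuous functions are smooth. -/
def SmithSpace.ofTop (X : Type u) [t : TopologicalSpace X] : SmithSpace.{u} where
  carrier := X
  top := t
  functions := {f | Continuous f}
  continuous_of_mem _ h := h
  mem_of_smooth _ h _ := h

/-- The exchange of the truth values does not preserve continuity of the map that is true on an
open half-line. -/
theorem not_continuous_swapProp_halfLine :
    ¬Continuous (swapProp.{u} ∘ fun x : (Set.univ : Set (Euc 1)) => ⟨0 < x.1 0⟩) := by
  intro h
  have h1 : Continuous fun t : ℝ =>
      (swapProp.{u} ∘ fun x : (Set.univ : Set (Euc 1)) => ⟨0 < x.1 0⟩)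
        ⟨WithLp.toLp 2 fun _ => t, trivial⟩ :=
    h.comp (Continuous.subtype_mk
      ((PiLp.continuous_toLp 2 _).comp (continuous_pi fun _ => continuous_id)) _)
  have h2 : IsOpen (Set.Iic (0 : ℝ)) := by
    simpa [swapProp, Set.Iic] using continuous_Prop.1 (continuous_uliftDown.comp h1)
  have := h2.interior_eq
  rw [interior_Iic] at this
  exact lt_irrefl (0 : ℝ) (this.symm ▸ (le_refl (0 : ℝ)) : (0 : ℝ) ∈ Set.Iio (0 : ℝ))

theorem continuous_halfLine :
    Continuous fun x : (Set.univ : Set (Euc 1)) => (⟨0 < x.1 0⟩ : ULift.{u} Prop) :=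
  continuous_uliftUp.comp (continuous_Prop.2 (isOpen_lt continuous_const (by fun_prop)))

theorem ChenSpace.not_isMor_swapProp :
    ¬IsMor (ChenSpace.ofTop (ULift.{u} Prop)) (ChenSpace.ofTop (ULift.{u} Prop)) swapProp :=
  fun h => not_continuous_swapProp_halfLine
    (ChenSpace.isMor_iff.1 h Set.univ _ ⟨convex_univ, continuous_halfLine⟩).2

theorem SouriauSpace.not_isMor_swapProp :
    ¬IsMor (SouriauSpace.ofTop (ULift.{u} Prop)) (SouriauSpace.ofTop (ULift.{u} Prop)) swapProp :=
  fun h => not_continuous_swapProp_halfLine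
    (SouriauSpace.isMor_iff.1 h Set.univ _ ⟨isOpen_univ, continuous_halfLine⟩).2

theorem SikorskiSpace.not_isMor_swapProp :
    ¬IsMor (SikorskiSpace.ofTop (ULift.{u} Prop)) (SikorskiSpace.ofTop (ULift.{u} Prop))
      swapProp :=
  fun h => not_continuous_swapProp (SikorskiSpace.isMor_iff.1 h).1

theorem SmithSpace.not_isMor_swapProp :
    ¬IsMor (SmithSpace.ofTop (ULift.{u} Prop)) (SmithSpace.ofTop (ULift.{u} Prop)) swapProp :=
  fun h => not_continuous_swapProp (SmithSpace.isMor_iff.1 h).1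

/-- On a two-point set, every function is carried by the exchange of the points to a constant
minus itself. -/
theorem comp_swapProp_conj {X : Type u} (β : ULift.{u} Prop ≃ X) (f : X → ℝ) (x : X) :
    f ((β ∘ swapProp ∘ β.symm) x) = f (β ⟨True⟩) + f (β ⟨False⟩) - f x := by
  obtain ⟨⟨p⟩, rfl⟩ := β.surjective x
  by_cases hp : p <;> simp [swapProp, hp]

/-- The two points of a two-point Frölicher space can be exchanged. -/
theorem FrolicherSpace.isMor_swapProp_conj (X : FrolicherSpace.{u})
    (β : ULift.{u} Prop ≃ pts X) : IsMor X X (β ∘ swapProp ∘ β.symm) := by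
  refine FrolicherSpace.isMor_iff.2 fun c hc => (X.mem_curves_iff _).2 fun f hf => ?_
  have h : f ∘ (β ∘ swapProp ∘ β.symm) ∘ c =
      fun t => f (β ⟨True⟩) + f (β ⟨False⟩) - (f ∘ c) t :=
    funext fun t => comp_swapProp_conj β f (c t)
  rw [h]
  exact contDiff_const.sub ((X.mem_curves_iff c).1 hc f hf)

/-- A category with a two-point object whose points cannot be exchanged is not equivalent to the
category of Frölicher spaces. -/
theorem isEmpty_equivalence_frolicher {C : Type (u + 1)} [Category.{u} C] [PointCategory C]
    (S : C) (β : pts S ≃ ULift.{u} Prop) (hS : ¬IsMor S S (β.symm ∘ swapProp ∘ β)) :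
    IsEmpty (C ≌ FrolicherSpace.{u}) := by
  refine ⟨fun e => ?_⟩
  obtain ⟨R, hC, -, hR⟩ := exists_correspondence e
  obtain ⟨Y, γ, hY⟩ := hC S
  exact hS ((hR hY hY _).2 (FrolicherSpace.isMor_swapProp_conj Y (β.symm.trans γ)))

/-! ### Sikorski spaces and Smith spaces -/

/-- A real-valued continuous function does not separate two points one of which lies in all
neighbourhoods of the other. -/
theorem eq_of_two_points {X : Type*} [TopologicalSpace X] {p q : X} (hpq : ∀ x, x = p ∨ x = q)
    (hq : ¬IsOpen {q}) {f : X → ℝ} (hf : Continuous f) (x : X) : f x = f p := by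
  have h : p ⤳ q := by
    refine specializes_iff_forall_open.2 fun s hs hqs => ?_
    by_contra hp
    refine hq ?_
    convert hs
    refine Set.Subset.antisymm (Set.singleton_subset_iff.2 hqs) fun y hy => ?_
    rcases hpq y with rfl | rfl
    exacts [absurd hy hp, rfl]
  rcases hpq x with rfl | rfl
  exacts [rfl, (h.map hf).eq.symm]

theorem isSmoothFun_of_locally_const {n : ℕ} {U : Set (Euc n)} (hU : IsOpen U) {h : U → ℝ}
    (hh : ∀ x : U, ∀ᶠ y in 𝓝 x, h y = h x) : IsSmoothFun U h := by
  classical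
  refine ⟨fun x => if hx : x ∈ U then h ⟨x, hx⟩ else 0, fun x hx => ?_, fun x => by simp⟩
  have h1 : ∀ᶠ y in 𝓝 x, ∀ hy : y ∈ U, h ⟨y, hy⟩ = h ⟨x, hx⟩ := by
    have := hh ⟨x, hx⟩
    rw [nhds_subtype_eq_comap, Filter.eventually_comap] at this
    filter_upwards [this] with y hy hyU using hy ⟨y, hyU⟩ rfl
  refine (contDiffAt_const (c := h ⟨x, hx⟩) |>.congr_of_eventuallyEq ?_).contDiffWithinAt
  filter_upwards [h1, hU.mem_nhds hx] with y hy hyU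
  rw [dif_pos hyU, hy hyU]

/-- If the clopen sets of a Smith space separate its points, then every continuous function is
smooth: all the continuous maps from open subsets of Euclidean spaces are locally constant. -/
theorem SmithSpace.mem_functions_of_clopen_separated (X : SmithSpace.{u})
    (hX : ∀ x y : X.carrier, x ≠ y → ∃ A : Set X.carrier, IsClopen A ∧ x ∈ A ∧ y ∉ A)
    {g : X.carrier → ℝ} (hg : Continuous g) : g ∈ X.functions := by
  refine X.mem_of_smooth g hg fun n U hU φ hφ => isSmoothFun_of_locally_const hU fun x => ?_
  have hlc : LocallyConnectedSpace U := hU.locallyConnectedSpace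
  filter_upwards [(isOpen_connectedComponent (x := x)).mem_nhds mem_connectedComponent] with y hy
  suffices h : φ y = φ x by simp [h]
  by_contra hne
  obtain ⟨A, hA, hyA, hxA⟩ := hX _ _ hne
  have := (hA.preimage hφ.1).connectedComponent_subset hyA
  rw [connectedComponent_eq hy |>.symm] at this
  exact hxA (this mem_connectedComponent)

/-- If the points of a two-point Smith space cannot be exchanged, then exactly one of them is
open. -/
theorem SmithSpace.exists_isOpen_singleton (X : SmithSpace.{u}) (β : ULift.{u} Prop ≃ X.carrier)
    (hX : ¬IsMor X X (β ∘ swapProp ∘ β.symm)) :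
    ∃ p q : X.carrier, p ≠ q ∧ (∀ x, x = p ∨ x = q) ∧ IsOpen {p} ∧ ¬IsOpen {q} := by
  have hne : β ⟨True⟩ ≠ β ⟨False⟩ := fun h => by simpa using β.injective h
  have hall (x : X.carrier) : x = β ⟨True⟩ ∨ x = β ⟨False⟩ := by
    obtain ⟨⟨p⟩, rfl⟩ := β.surjective x
    by_cases hp : p <;> simp [hp]
  by_cases h1 : IsOpen {β ⟨True⟩}
  · by_cases h2 : IsOpen {β ⟨False⟩}
    · exfalso
      have hd : DiscreteTopology X.carrier := by
        refine discreteTopology_iff_isOpen_singleton.2 fun x => ?_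
        rcases hall x with rfl | rfl <;> assumption
      refine hX (SmithSpace.isMor_iff.2 ⟨continuous_of_discreteTopology, fun f hf => ?_⟩)
      exact X.mem_functions_of_clopen_separated
        (fun x y hxy => ⟨{x}, isClopen_discrete _, rfl, fun h => hxy h.symm⟩)
        continuous_of_discreteTopology
    · exact ⟨_, _, hne, hall, h1, h2⟩
  · by_cases h2 : IsOpen {β ⟨False⟩}
    · exact ⟨_, _, hne.symm, fun x => (hall x).symm, h2, h1⟩
    · exfalso
      -- the topology is indiscrete
      have hs (s : Set X.carrier) (hs : IsOpen s) : s = ∅ ∨ s = Set.univ := by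
        by_cases hT : β ⟨True⟩ ∈ s <;> by_cases hF : β ⟨False⟩ ∈ s
        · right
          ext x
          rcases hall x with rfl | rfl <;> simp [hT, hF]
        · refine absurd ?_ h1
          convert hs
          ext x
          rcases hall x with rfl | rfl <;> simp [hT, hF, hne.symm]
        · refine absurd ?_ h2
          convert hs
          ext x
          rcases hall x with rfl | rfl <;> simp [hT, hF, hne]
        · left
          ext x
          rcases hall x with rfl | rfl <;> simp [hT, hF]
      refine hX (SmithSpace.isMor_iff.2 ⟨⟨fun s h => ?_⟩, fun f hf => ?_⟩)
      · rcases hs s h with rfl | rfl <;> simp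
      · convert hf using 1
        funext x
        have hc := eq_of_two_points hall h2 (X.continuous_of_mem f hf)
        simp only [Function.comp_apply]
        rw [hc, hc x]

/-- A Sierpinski space detects open sets: the characteristic map of an open set is a morphism. -/
theorem SmithSpace.isMor_indicator {X S : SmithSpace.{u}} {p q : S.carrier}
    (hpq : ∀ x, x = p ∨ x = q) (hq : ¬IsOpen {q}) {V : Set X.carrier} (hV : IsOpen V)
    [DecidablePred (· ∈ V)] : IsMor X S fun x => if x ∈ V then p else q := by
  refine SmithSpace.isMor_iff.2 ⟨⟨fun s hs => ?_⟩, fun f hf => ?_⟩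
  · by_cases h1 : p ∈ s <;> by_cases h2 : q ∈ s
    · convert isOpen_univ
      ext x
      by_cases hx : x ∈ V <;> simp [h1, h2, hx]
    · convert hV
      ext x
      by_cases hx : x ∈ V <;> simp [h1, h2, hx]
    · refine absurd ?_ hq
      convert hs
      ext x
      have : q ≠ p := fun h => h1 (h ▸ h2)
      rcases hpq x with rfl | rfl <;> simp [h1, h2, this.symm]
    · convert isOpen_empty
      ext x
      by_cases hx : x ∈ V <;> simp [h1, h2, hx]
  · have hc := eq_of_two_points hpq hq (S.continuous_of_mem f hf)
    have : f ∘ (fun x => if x ∈ V then p else q) = fun _ : X.carrier => f p :=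
      funext fun x => hc _
    refine this ▸ X.mem_of_smooth _ continuous_const
      fun _ _ _ _ _ => ⟨fun _ => f p, contDiffOn_const, fun _ => rfl⟩

/-- All continuous maps to the Sierpinski space are morphisms, as the smooth functions on it are
constant. -/
theorem SikorskiSpace.isMor_sierpinski_iff {X : SikorskiSpace.{u}}
    {f : X.carrier → ULift.{u} Prop} :
    IsMor X (SikorskiSpace.ofTop (ULift.{u} Prop)) f ↔ Continuous f := by
  refine SikorskiSpace.isMor_iff.trans ⟨fun h => h.1, fun h => ⟨h, fun g hg => ?_⟩⟩
  have hq : ¬IsOpen {(⟨False⟩ : ULift.{u} Prop)} := fun ho => by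
    have h1 : IsOpen {p : Prop | (⟨p⟩ : ULift.{u} Prop) = ⟨False⟩} := ho.preimage continuous_uliftUp
    have h2 := h1.mem_nhds (x := False) rfl
    rw [nhds_false, Filter.mem_top] at h2
    have : True ∈ {p : Prop | (⟨p⟩ : ULift.{u} Prop) = ⟨False⟩} := h2 ▸ trivial
    simp at this
  have hc := eq_of_two_points (p := (⟨True⟩ : ULift.{u} Prop)) (q := ⟨False⟩)
    (fun x => by
      rcases x with ⟨x⟩
      by_cases hx : x <;> simp [hx]) hq (f := g) hg
  have : g ∘ f = fun _ : X.carrier => g ⟨True⟩ := funext fun x => hc _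
  rw [this]
  exact X.functions.algebraMap_mem (g ⟨True⟩)

/-- A topological space as a Sikorski space: the smooth functions are the locally constant ones. -/
def SikorskiSpace.locallyConstant (X : Type u) [t : TopologicalSpace X] : SikorskiSpace.{u} where
  carrier := X
  top := t
  functions :=
    { carrier := {f | IsLocallyConstant f}
      mul_mem' := fun h h' => IsLocallyConstant.mul h h'
      add_mem' := fun h h' => IsLocallyConstant.add h h'
      algebraMap_mem' := fun r => IsLocallyConstant.const r }
  continuous_of_mem _ h := IsLocallyConstant.continuous h
  mem_of_local f hf := by
    refine (IsLocallyConstant.iff_eventually_eq f).2 fun x => ?_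
    obtain ⟨V, hV, g, hg, hfg⟩ := hf x
    filter_upwards [hV, (IsLocallyConstant.iff_eventually_eq g).1 hg x] with y hy hgy
    rw [hfg hy, hgy, hfg (mem_of_mem_nhds hV)]
  smooth_comp_mem k f g hf _ := by
    refine (IsLocallyConstant.iff_eventually_eq _).2 fun x => ?_
    filter_upwards [Filter.eventually_all.2 fun i =>
      (IsLocallyConstant.iff_eventually_eq (f i)).1 (hf i) x] with y hy
    simp [hy]

theorem not_isLocallyConstant_ratCast :
    ¬IsLocallyConstant fun x : ULift.{u} ℚ => (x.down : ℝ) := by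
  intro h
  have h1 := (h.comp_continuous continuous_uliftUp).isOpen_fiber 0
  have h2 : IsOpen {(0 : ℚ)} := by
    convert h1
    ext x
    simp
  exact not_isOpen_singleton (0 : ℚ) h2

theorem exists_isClopen_rat {x y : ULift.{u} ℚ} (h : x ≠ y) :
    ∃ A : Set (ULift.{u} ℚ), IsClopen A ∧ x ∈ A ∧ y ∉ A := by
  have key (r : ℝ) (hr : Irrational r) : IsClopen {z : ULift.{u} ℚ | (z.down : ℝ) < r} := by
    have hc : Continuous fun z : ULift.{u} ℚ => (z.down : ℝ) :=
      Rat.continuous_coe_real.comp continuous_uliftDown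
    refine ⟨?_, isOpen_lt hc continuous_const⟩
    convert isClosed_le hc (continuous_const (y := r)) using 1
    ext z
    exact (lt_iff_le_and_ne.trans (and_iff_left fun h => hr ⟨_, h⟩) : (z.down : ℝ) < r ↔ _)
  rcases lt_or_gt_of_ne (fun h' => h (ULift.down_injective h') : x.down ≠ y.down) with h | h
  · obtain ⟨r, hr, h1, h2⟩ := exists_irrational_btwn (Rat.cast_lt (K := ℝ).2 h)
    exact ⟨_, key r hr, h1, not_lt.2 h2.le⟩
  · obtain ⟨r, hr, h1, h2⟩ := exists_irrational_btwn (Rat.cast_lt (K := ℝ).2 h)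
    exact ⟨_, (key r hr).compl, not_lt.2 h2.le, fun h => h h1⟩

theorem isEmpty_equivalence_sikorski_smith :
    IsEmpty (SikorskiSpace.{u} ≌ SmithSpace.{u}) := by
  classical
  refine ⟨fun e => ?_⟩
  obtain ⟨R, hC, -, hR⟩ := exists_correspondence e
  let S := SikorskiSpace.ofTop (ULift.{u} Prop)
  let X₁ := SikorskiSpace.locallyConstant (ULift.{u} ℚ)
  let X₂ := SikorskiSpace.ofTop (ULift.{u} ℚ)
  obtain ⟨T, (σ : ULift.{u} Prop ≃ T.carrier), hT⟩ := hC S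
  obtain ⟨Y₁, (β₁ : ULift.{u} ℚ ≃ Y₁.carrier), h₁⟩ := hC X₁
  obtain ⟨Y₂, (β₂ : ULift.{u} ℚ ≃ Y₂.carrier), h₂⟩ := hC X₂
  obtain ⟨p, q, hpq, hall, hp, hq⟩ := T.exists_isOpen_singleton σ
    fun h => SikorskiSpace.not_isMor_swapProp ((hR hT hT _).2 h)
  have hid : ¬IsMor X₁ X₂ id := fun h => not_isLocallyConstant_ratCast <|
    (SikorskiSpace.isMor_iff.1 h).2 (fun x : ULift.{u} ℚ => (x.down : ℝ))
      (Rat.continuous_coe_real.comp continuous_uliftDown)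
  refine hid ((hR h₁ h₂ id).2 ?_)
  -- continuous maps to the Sierpinski space stay continuous on the other side
  have hmor₁ (k : ULift.{u} ℚ → ULift.{u} Prop) (hk : Continuous k) :
      Continuous (fun y : Y₁.carrier => σ (k (β₁.symm y))) :=
    (SmithSpace.isMor_iff.1 ((hR h₁ hT k).1 (SikorskiSpace.isMor_sierpinski_iff.2 hk))).1
  have hcont : Continuous (β₂ ∘ id ∘ β₁.symm : Y₁.carrier → Y₂.carrier) := by
    refine ⟨fun V hV => ?_⟩
    have hχ := SmithSpace.isMor_indicator (X := Y₂) hall hq hV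
    let k : ULift.{u} ℚ → ULift.{u} Prop := fun x => σ.symm (if β₂ x ∈ V then p else q)
    have hk : IsMor X₂ S k := by
      refine (hR h₂ hT k).2 ?_
      convert hχ using 1
      funext y
      exact (σ.apply_symm_apply _).trans
        (congrArg (fun z => if z ∈ V then p else q) (β₂.apply_symm_apply y))
    have h := (hmor₁ k (SikorskiSpace.isMor_sierpinski_iff.1 hk)).isOpen_preimage _ hp
    convert h using 1
    ext y
    by_cases hy : β₂ (β₁.symm y) ∈ V
    · simp [k, hy]
    · simp [k, hy, hpq.symm]
  have hopen (A : Set (ULift.{u} ℚ)) (hA : IsClopen A) : IsOpen (β₁.symm ⁻¹' A) := by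
    obtain ⟨P, hP⟩ : ∃ P : Prop, σ.symm p = ⟨P⟩ := ⟨_, rfl⟩
    -- which point of the Sierpinski space is open on the other side is not known
    have hk : Continuous fun x : ULift.{u} ℚ => (⟨x ∈ A ↔ P⟩ : ULift.{u} Prop) := by
      refine continuous_uliftUp.comp (continuous_Prop.2 ?_)
      by_cases hP : P
      · simpa [hP] using hA.isOpen
      · simp only [hP, iff_false]
        exact hA.compl.isOpen
    convert (hmor₁ _ hk).isOpen_preimage _ hp using 1
    ext y
    rw [Set.mem_preimage, Set.mem_preimage, Set.mem_singleton_iff, ← Equiv.eq_symm_apply, hP]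
    by_cases hP : P <;> simp [hP]
  refine SmithSpace.isMor_iff.2 ⟨hcont, fun f hf => ?_⟩
  refine Y₁.mem_functions_of_clopen_separated (fun x y hxy => ?_)
    ((Y₂.continuous_of_mem f hf).comp hcont)
  obtain ⟨A, hA, hx, hy⟩ := exists_isClopen_rat (β₁.symm.injective.ne hxy)
  exact ⟨β₁.symm ⁻¹' A, ⟨⟨by simpa using hopen _ hA.compl⟩, hopen _ hA⟩, hx, hy⟩

/-! ### Induced Chen and Souriau structures -/

section Induced

variable {E : Type*} [NormedAddCommGroup E] [NormedSpace ℝ E]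
variable {E' : Type*} [NormedAddCommGroup E'] [NormedSpace ℝ E']

/-- A map on a subset of a Euclidean space is smooth along that subset: it is the restriction of
a total map that is smooth on the subset. -/
def SmoothAlong {n : ℕ} (C : Set (Euc n)) (h : C → E) : Prop :=
  ∃ g : Euc n → E, ContDiffOn ℝ ∞ g C ∧ ∀ x : C, g x = h x

theorem SmoothAlong.of_local {n : ℕ} {C : Set (Euc n)} {h : C → E}
    (hh : ∀ x ∈ C, ∃ (V : Set (Euc n)) (hV : V ⊆ C), V ∈ 𝓝[C] x ∧
      SmoothAlong V (h ∘ Set.inclusion hV)) : SmoothAlong C h := by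
  classical
  refine ⟨fun x => if hx : x ∈ C then h ⟨x, hx⟩ else 0, fun x hx => ?_, fun x => by simp⟩
  obtain ⟨V, hV, hVx, g, hg, hgh⟩ := hh x hx
  have hxV : x ∈ V := mem_of_mem_nhdsWithin hx hVx
  refine ((hg x hxV).congr (fun y hy => ?_) ?_).mono_of_mem_nhdsWithin hVx
  · rw [hgh ⟨y, hy⟩, dif_pos (hV hy)]
    rfl
  · rw [hgh ⟨x, hxV⟩, dif_pos hx]
    rfl

theorem SmoothAlong.const {n : ℕ} (C : Set (Euc n)) (y : E) : SmoothAlong C fun _ => y :=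
  ⟨fun _ => y, contDiffOn_const, fun _ => rfl⟩

theorem SmoothAlong.comp_restrict {n m : ℕ} {C : Set (Euc n)} {C' : Set (Euc m)} {h : C → E}
    (hh : SmoothAlong C h) {θ : Euc m → Euc n} (hθ : ContDiffOn ℝ ∞ θ C')
    (hm : Set.MapsTo θ C' C) : SmoothAlong C' (h ∘ hm.restrict θ C' C) := by
  obtain ⟨g, hg, hgh⟩ := hh
  exact ⟨g ∘ θ, hg.comp hθ hm, fun x => hgh ⟨θ x, hm x.2⟩⟩

theorem SmoothAlong.contDiff_comp {n : ℕ} {C : Set (Euc n)} {h : C → E}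
    (hh : SmoothAlong C h) {F : E → E'} (hF : ContDiff ℝ ∞ F) : SmoothAlong C (F ∘ h) := by
  obtain ⟨g, hg, hgh⟩ := hh
  exact ⟨F ∘ g, hF.comp_contDiffOn hg, fun x => congrArg F (hgh x)⟩

/-- The coordinate embedding of the real line in `Euc 1`. -/
def toEuc (t : ℝ) : Euc 1 := WithLp.toLp 2 fun _ => t

theorem contDiff_toEuc : ContDiff ℝ ∞ toEuc :=
  PiLp.contDiff_toLp.comp (contDiff_pi.2 fun _ => contDiff_id)

theorem contDiff_apply_euc {n : ℕ} (i : Fin n) : ContDiff ℝ ∞ fun x : Euc n => x i :=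
  contDiff_piLp_apply (𝕜 := ℝ) (p := 2)

theorem smoothAlong_pi {n m : ℕ} {C : Set (Euc n)} {h : C → Euc m}
    (hh : ∀ i, SmoothAlong C fun x => h x i) : SmoothAlong C h := by
  choose g hg hgh using hh
  refine ⟨fun x => WithLp.toLp 2 fun i => g i x, ?_, fun x => ?_⟩
  · exact PiLp.contDiff_toLp.comp_contDiffOn (contDiffOn_pi.2 hg)
  · ext i
    exact hgh i x

/-- A set mapped to a normed space, as a Chen space: the plots are the maps that become smooth. -/
def ChenSpace.induced {α : Type u} (ι : α → E) : ChenSpace.{u} where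
  carrier := α
  IsPlot C φ := Convex ℝ C ∧ SmoothAlong C (ι ∘ φ)
  convex_of_isPlot h := h.1
  isPlot_const {_ C} h x := ⟨h, .const C (ι x)⟩
  isPlot_comp h h' hθ hm := ⟨h', h.2.comp_restrict hθ hm⟩
  isPlot_of_local h hφ := ⟨h, .of_local fun x hx =>
    let ⟨V, hV, hVx, _, hs⟩ := hφ x hx
    ⟨V, hV, hVx, hs.2⟩⟩

/-- A set mapped to a normed space, as a Souriau space: the plots are the maps that become
smooth. -/
def SouriauSpace.induced {α : Type u} (ι : α → E) : SouriauSpace.{u} where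
  carrier := α
  IsPlot U φ := IsOpen U ∧ SmoothAlong U (ι ∘ φ)
  isOpen_of_isPlot h := h.1
  isPlot_const {_ C} h x := ⟨h, .const C (ι x)⟩
  isPlot_comp h h' hθ hm := ⟨h', h.2.comp_restrict hθ hm⟩
  isPlot_of_local h hφ := ⟨h, .of_local fun x hx =>
    let ⟨V, hV, hVx, hVo, hs⟩ := hφ x hx
    ⟨V, hV, mem_nhdsWithin_of_mem_nhds (hVo.mem_nhds hVx), hs.2⟩⟩

theorem ChenSpace.isMor_induced {α β : Type u} {ι : α → E} {κ : β → E'} {f : α → β} {F : E → E'}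
    (hF : ContDiff ℝ ∞ F) (h : ∀ x, κ (f x) = F (ι x)) :
    IsMor (ChenSpace.induced ι) (ChenSpace.induced κ) f := by
  refine ChenSpace.isMor_iff.2 fun C φ hφ => ⟨hφ.1, ?_⟩
  have : κ ∘ f ∘ φ = F ∘ ι ∘ φ := funext fun x => h (φ x)
  exact this ▸ hφ.2.contDiff_comp hF

theorem SouriauSpace.isMor_induced {α β : Type u} {ι : α → E} {κ : β → E'} {f : α → β}
    {F : E → E'} (hF : ContDiff ℝ ∞ F) (h : ∀ x, κ (f x) = F (ι x)) :
    IsMor (SouriauSpace.induced ι) (SouriauSpace.induced κ) f := by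
  refine SouriauSpace.isMor_iff.2 fun C φ hφ => ⟨hφ.1, ?_⟩
  have : κ ∘ f ∘ φ = F ∘ ι ∘ φ := funext fun x => h (φ x)
  exact this ▸ hφ.2.contDiff_comp hF

end Induced

theorem ChenSpace.isPlot_factor {X : ChenSpace.{u}} {n m : ℕ} {C : Set (Euc n)}
    {φ : C → X.carrier} (hφ : X.IsPlot C φ) {D : Set (Euc m)} (hD : Convex ℝ D) {h : D → Euc n}
    (hh : SmoothAlong D h) (hm : ∀ d, h d ∈ C) : X.IsPlot D fun d => φ ⟨h d, hm d⟩ := by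
  obtain ⟨g, hg, hgh⟩ := hh
  convert X.isPlot_comp hφ hD hg fun x hx => by
    rw [hgh ⟨x, hx⟩]
    exact hm _ using 1
  funext d
  exact congrArg φ (Subtype.ext (hgh d).symm)

theorem SouriauSpace.isPlot_factor {X : SouriauSpace.{u}} {n m : ℕ} {C : Set (Euc n)}
    {φ : C → X.carrier} (hφ : X.IsPlot C φ) {D : Set (Euc m)} (hD : IsOpen D) {h : D → Euc n}
    (hh : SmoothAlong D h) (hm : ∀ d, h d ∈ C) : X.IsPlot D fun d => φ ⟨h d, hm d⟩ := by
  obtain ⟨g, hg, hgh⟩ := hh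
  convert X.isPlot_comp hφ hD hg fun x hx => by
    rw [hgh ⟨x, hx⟩]
    exact hm _ using 1
  funext d
  exact congrArg φ (Subtype.ext (hgh d).symm)

/-! ### The real line -/

/-- The real line as a Chen space. -/
noncomputable abbrev ChenSpace.real : ChenSpace.{u} :=
  ChenSpace.induced (ULift.down : ULift.{u} ℝ → ℝ)

/-- The space `ℝⁿ` as a Souriau space. -/
noncomputable abbrev SouriauSpace.euc (n : ℕ) : SouriauSpace.{u} :=
  SouriauSpace.induced (ULift.down : ULift.{u} (Euc n) → Euc n)

/-- The real line as a Souriau space. -/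
noncomputable abbrev SouriauSpace.real : SouriauSpace.{u} :=
  SouriauSpace.induced (ULift.down : ULift.{u} ℝ → ℝ)

theorem contDiff_of_smoothAlong {f : ℝ → ℝ}
    (h : SmoothAlong Set.univ fun x : (Set.univ : Set (Euc 1)) => f (x.1 0)) :
    ContDiff ℝ ∞ f := by
  obtain ⟨g, hg, hgf⟩ := h
  have : f = g ∘ toEuc := funext fun t => (hgf ⟨toEuc t, trivial⟩).symm
  exact this ▸ (contDiffOn_univ.1 hg).comp contDiff_toEuc

theorem ChenSpace.contDiff_of_isMor_real {f : ULift.{u} ℝ → ULift.{u} ℝ}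
    (hf : IsMor ChenSpace.real ChenSpace.real f) : ContDiff ℝ ∞ fun t => (f ⟨t⟩).down :=
  contDiff_of_smoothAlong (ChenSpace.isMor_iff.1 hf Set.univ (fun x => ⟨x.1 0⟩)
    ⟨convex_univ, _, (contDiff_apply_euc 0).contDiffOn, fun _ => rfl⟩).2

theorem SouriauSpace.contDiff_of_isMor_real {f : ULift.{u} ℝ → ULift.{u} ℝ}
    (hf : IsMor SouriauSpace.real SouriauSpace.real f) : ContDiff ℝ ∞ fun t => (f ⟨t⟩).down :=
  contDiff_of_smoothAlong (SouriauSpace.isMor_iff.1 hf Set.univ (fun x => ⟨x.1 0⟩)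
    ⟨isOpen_univ, _, (contDiff_apply_euc 0).contDiffOn, fun _ => rfl⟩).2

theorem ChenSpace.isMor_curve {X : ChenSpace.{u}} {n : ℕ} {C : Set (Euc n)} {φ : C → X.carrier}
    (hφ : X.IsPlot C φ) {γ : ℝ → Euc n} (hγ : ContDiff ℝ ∞ γ) (hm : ∀ t, γ t ∈ C) :
    IsMor ChenSpace.real X fun t => φ ⟨γ t.down, hm t.down⟩ :=
  ChenSpace.isMor_iff.2 fun _ _ hψ =>
    ChenSpace.isPlot_factor hφ hψ.1 (hψ.2.contDiff_comp hγ) fun _ => hm _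

theorem SouriauSpace.isMor_curve {X : SouriauSpace.{u}} {n : ℕ} {C : Set (Euc n)}
    {φ : C → X.carrier} (hφ : X.IsPlot C φ) {γ : ℝ → Euc n} (hγ : ContDiff ℝ ∞ γ)
    (hm : ∀ t, γ t ∈ C) : IsMor SouriauSpace.real X fun t => φ ⟨γ t.down, hm t.down⟩ :=
  SouriauSpace.isMor_iff.2 fun _ _ hψ =>
    SouriauSpace.isPlot_factor hφ hψ.1 (hψ.2.contDiff_comp hγ) fun _ => hm _

/-- Any two points of a convex set lie on a smooth curve, defined on the whole real line, in the
set. -/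
theorem exists_curve_of_convex {n : ℕ} {C : Set (Euc n)} (hC : Convex ℝ C) {a b : Euc n}
    (ha : a ∈ C) (hb : b ∈ C) :
    ∃ γ : ℝ → Euc n, ContDiff ℝ ∞ γ ∧ (∀ t, γ t ∈ C) ∧ γ 0 = a ∧ γ 1 = b := by
  refine ⟨fun t => a + Real.smoothTransition t • (b - a), ?_, fun t => ?_, by simp, by simp⟩
  · exact contDiff_const.add (Real.smoothTransition.contDiff.smul contDiff_const)
  · exact hC.add_smul_sub_mem ha hb
      ⟨Real.smoothTransition.nonneg t, Real.smoothTransition.le_one t⟩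

/-- A Chen space without nonconstant curves is discrete. -/
theorem ChenSpace.isMor_of_curves_const {X : ChenSpace.{u}}
    (hX : ∀ c, IsMor ChenSpace.real X c → ∀ s t, c s = c t) (Y : ChenSpace.{u})
    (f : X.carrier → Y.carrier) : IsMor X Y f := by
  refine ChenSpace.isMor_iff.2 fun {n} C φ hφ => ?_
  have hC := X.convex_of_isPlot hφ
  rcases C.eq_empty_or_nonempty with rfl | ⟨a, ha⟩
  · exact Y.isPlot_of_local hC fun x hx => hx.elim
  · convert Y.isPlot_const hC (f (φ ⟨a, ha⟩)) using 1
    funext ⟨b, hb⟩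
    obtain ⟨γ, hγ, hm, h0, h1⟩ := exists_curve_of_convex hC ha hb
    have := hX _ (ChenSpace.isMor_curve hφ hγ hm) ⟨1⟩ ⟨0⟩
    simp only [h0, h1] at this
    simp [this]

/-- A Souriau space without nonconstant curves is discrete. -/
theorem SouriauSpace.isMor_of_curves_const {X : SouriauSpace.{u}}
    (hX : ∀ c, IsMor SouriauSpace.real X c → ∀ s t, c s = c t) (Y : SouriauSpace.{u})
    (f : X.carrier → Y.carrier) : IsMor X Y f := by
  refine SouriauSpace.isMor_iff.2 fun {n} U φ hφ => ?_
  have hU := X.isOpen_of_isPlot hφ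
  refine Y.isPlot_of_local hU fun a ha => ?_
  obtain ⟨r, hr, hrU⟩ := Metric.isOpen_iff.1 hU a ha
  refine ⟨Metric.ball a r, hrU, Metric.mem_ball_self hr, Metric.isOpen_ball, ?_⟩
  convert Y.isPlot_const Metric.isOpen_ball (f (φ ⟨a, ha⟩)) using 1
  funext ⟨b, hb⟩
  obtain ⟨γ, hγ, hm, h0, h1⟩ :=
    exists_curve_of_convex (convex_ball a r) (Metric.mem_ball_self hr) hb
  have := hX _ (SouriauSpace.isMor_curve hφ hγ fun t => hrU (hm t)) ⟨1⟩ ⟨0⟩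
  simp only [h0, h1] at this
  simp [this, Set.inclusion]

theorem not_contDiff_abs : ¬ContDiff ℝ ∞ fun t : ℝ => |t| := fun h =>
  not_differentiableAt_abs_zero ((h.differentiable (by simp)) 0)

/-! ### Smooth functions with nonvanishing derivative -/

theorem injective_of_deriv_ne_zero {f : ℝ → ℝ} (hf : Differentiable ℝ f)
    (hf' : ∀ x, deriv f x ≠ 0) : Function.Injective f := by
  intro x y hxy
  by_contra hne
  wlog hlt : x < y generalizing x y
  · exact this hxy.symm (Ne.symm hne) (lt_of_le_of_ne (not_lt.1 hlt) (Ne.symm hne))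
  obtain ⟨c, -, hc⟩ := exists_deriv_eq_zero hlt hf.continuous.continuousOn hxy
  exact hf' c hc

/-- A map is smooth if its composite with a function of nonvanishing derivative is. -/
theorem smoothAlong_of_comp {f : ℝ → ℝ} (hf : ContDiff ℝ ∞ f) (hf' : ∀ x, deriv f x ≠ 0)
    {n : ℕ} {U : Set (Euc n)} {φ : U → ℝ} (h : SmoothAlong U (f ∘ φ)) : SmoothAlong U φ := by
  have hd : Differentiable ℝ f := hf.differentiable (by simp)
  have hopen : IsOpenMap f := isOpenMap_iff_nhds_le.2 fun x =>
    ((hf.contDiffAt.hasStrictDerivAt (by simp)).map_nhds_eq (hf' x)).ge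
  have hemb : IsOpenEmbedding f := .of_continuous_injective_isOpenMap hf.continuous
    (injective_of_deriv_ne_zero hd hf') hopen
  let Φ := hemb.toOpenPartialHomeomorph f
  have hΦ (t : ℝ) : Φ.symm (f t) = t := Φ.left_inv (x := t) trivial
  obtain ⟨g, hg, hgf⟩ := h
  refine ⟨Φ.symm ∘ g, fun x hx => ?_, fun x => ?_⟩
  · refine ContDiffAt.comp_contDiffWithinAt x ?_ (hg x hx)
    have hx' : g x = f (φ ⟨x, hx⟩) := hgf ⟨x, hx⟩
    rw [hx']
    refine Φ.contDiffAt_symm_deriv (f₀' := deriv f (φ ⟨x, hx⟩)) (hf' _) ⟨_, trivial, rfl⟩ ?_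
      hf.contDiffAt
    rw [hΦ]
    exact (hd _).hasDerivAt
  · simp only [Function.comp_apply]
    rw [hgf x]
    exact hΦ _

/-- A nonconstant smooth function has nonvanishing derivative after a reparametrization by a
bounded interval. -/
theorem exists_comp_deriv_ne_zero {e : ℝ → ℝ} (he : ContDiff ℝ ∞ e) {c d : ℝ} (hcd : e c ≠ e d) :
    ∃ j : ℝ → ℝ, ContDiff ℝ ∞ j ∧ ∀ x, deriv (e ∘ j) x ≠ 0 := by
  have hd : Differentiable ℝ e := he.differentiable (by simp)
  obtain ⟨x₀, hx₀⟩ : ∃ x₀, deriv e x₀ ≠ 0 := by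
    by_contra! h
    exact hcd (is_const_of_deriv_eq_zero hd h c d)
  have hc : Continuous (deriv e) := he.continuous_deriv (by simp)
  obtain ⟨r, hr, hball⟩ := Metric.isOpen_iff.1 (isOpen_ne.preimage hc) x₀ hx₀
  have hj (x : ℝ) : HasDerivAt (fun t => x₀ + r / 2 * Real.arctan t) (r / 2 * (1 / (1 + x ^ 2))) x :=
    ((Real.hasDerivAt_arctan x).const_mul _).const_add _
  refine ⟨fun t => x₀ + r / 2 * Real.arctan t,
    contDiff_const.add (contDiff_const.mul Real.contDiff_arctan), fun x => ?_⟩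
  rw [((hd _).hasDerivAt.comp x (hj x)).deriv]
  refine mul_ne_zero (hball ?_) (by positivity)
  rw [Metric.mem_ball, Real.dist_eq, add_sub_cancel_left, abs_mul, abs_of_pos (by positivity)]
  have h2 : |Real.arctan x| < 2 :=
    abs_lt.2 ⟨by linarith [Real.neg_pi_div_two_lt_arctan x, Real.pi_lt_four],
      by linarith [Real.arctan_lt_pi_div_two x, Real.pi_lt_four]⟩
  nlinarith

/-! ### Two Chen structures on the half-line -/

/-- The half-line as a Chen space: the plots are the nonnegative smooth functions. -/
noncomputable abbrev ChenSpace.halfLine : ChenSpace.{u} :=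
  ChenSpace.induced (fun x : ULift.{u} NNReal => (x.down : ℝ))

/-- The half-line with fewer plots: the derivative of a plot is required to vanish where the plot
vanishes.  On open domains this holds for all smooth nonnegative functions. -/
def ChenSpace.flatHalfLine : ChenSpace.{u} where
  carrier := ULift.{u} NNReal
  IsPlot {n} C φ := Convex ℝ C ∧ ∃ g : Euc n → ℝ, ContDiffOn ℝ ∞ g C ∧
    (∀ x : C, g x = (φ x).down) ∧ ∀ x ∈ C, g x = 0 → HasFDerivWithinAt g 0 C x
  convex_of_isPlot h := h.1
  isPlot_const h x := ⟨h, fun _ => x.down, contDiffOn_const, fun _ => rfl,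
    fun _ _ _ => hasFDerivWithinAt_const _ _ _⟩
  isPlot_comp := by
    rintro n m C C' φ θ ⟨-, g, hg, hgφ, h0⟩ hC' hθ hm
    refine ⟨hC', g ∘ θ, hg.comp hθ hm, fun x => hgφ ⟨θ x, hm x.2⟩, fun x hx hx0 => ?_⟩
    have h1 := (hθ.differentiableOn (by simp) x hx).hasFDerivWithinAt
    simpa using (h0 (θ x) (hm hx) hx0).comp x h1 hm
  isPlot_of_local := by
    intro n C φ hC hφ
    obtain ⟨g, hg, hgφ⟩ : SmoothAlong C fun x => ((φ x).down : ℝ) := .of_local fun x hx =>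
      let ⟨V, hV, hVx, _, _, g, hg, hgφ, _⟩ := hφ x hx
      ⟨V, hV, hVx, g, hg, hgφ⟩
    refine ⟨hC, g, hg, hgφ, fun x hx hx0 => ?_⟩
    obtain ⟨V, hV, hVx, -, -, g', -, hgφ', h0⟩ := hφ x hx
    have hxV : x ∈ V := mem_of_mem_nhdsWithin hx hVx
    have heq : Set.EqOn g g' V := fun y hy => (hgφ ⟨y, hV hy⟩).trans (hgφ' ⟨y, hy⟩).symm
    exact ((h0 x hxV (heq hxV ▸ hx0)).congr heq (heq hxV)).mono_of_mem_nhdsWithin hVx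

theorem ChenSpace.isPlot_flatHalfLine_of_isOpen {n : ℕ} {U : Set (Euc n)} (hU : IsOpen U)
    {φ : U → ULift.{u} NNReal} (h : ChenSpace.halfLine.IsPlot U φ) :
    ChenSpace.flatHalfLine.IsPlot U φ := by
  obtain ⟨hC, g, hg, hgφ⟩ := h
  refine ⟨hC, g, hg, hgφ, fun x hx hx0 => ?_⟩
  have hmin : IsLocalMin g x := by
    filter_upwards [hU.mem_nhds hx] with y hy
    rw [hx0, hgφ ⟨y, hy⟩]
    exact NNReal.coe_nonneg _
  have hd := ((hg.contDiffAt (hU.mem_nhds hx)).differentiableAt (by simp)).hasFDerivAt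
  rw [hmin.hasFDerivAt_eq_zero hd] at hd
  exact hd.hasFDerivWithinAt

theorem ChenSpace.not_isMor_flatHalfLine :
    ¬IsMor ChenSpace.halfLine.{u} ChenSpace.flatHalfLine.{u} id := by
  intro h
  have hconv : Convex ℝ {x : Euc 1 | 0 ≤ x 0} := by
    intro x hx y hy a b ha hb _
    simp only [Set.mem_ofPred_eq, PiLp.add_apply, PiLp.smul_apply, smul_eq_mul] at *
    positivity
  obtain ⟨-, g, -, hgφ, h0⟩ := ChenSpace.isMor_iff.1 h {x : Euc 1 | 0 ≤ x 0}
    (fun x => ⟨⟨x.1 0, x.2⟩⟩) ⟨hconv, _, (contDiff_apply_euc 0).contDiffOn, fun _ => rfl⟩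
  have hg (t : ℝ) (ht : t ∈ Set.Ici (0 : ℝ)) : g (toEuc t) = t := hgφ ⟨toEuc t, ht⟩
  have h1 : HasFDerivWithinAt (g ∘ toEuc) (0 : ℝ →L[ℝ] ℝ) (Set.Ici 0) 0 := by
    have h2 := (contDiff_toEuc.differentiable (by simp) 0).hasFDerivAt.hasFDerivWithinAt
      (s := Set.Ici (0 : ℝ))
    simpa using (h0 (toEuc 0) (le_refl (0 : ℝ)) (hg 0 Set.self_mem_Ici)).comp 0 h2 fun t ht => ht
  have h3 : HasFDerivWithinAt id (ContinuousLinearMap.id ℝ ℝ) (Set.Ici (0 : ℝ)) 0 :=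
    hasFDerivWithinAt_id _ _
  have h4 := (uniqueDiffOn_Ici (0 : ℝ) 0 Set.self_mem_Ici).eq
    (h1.congr (fun t ht => (hg t ht).symm) (hg 0 Set.self_mem_Ici).symm) h3
  simpa using DFunLike.congr_fun h4 1

/-! ### Embeddings of Chen spaces into the real line -/

/-- A family of maps out of `X` reflects morphisms: a map into `X` is a morphism as soon as all its
composites with the family are. -/
def ReflectsMor {C : Type (u + 1)} [Category.{u} C] [PointCategory C] {I : Type} (X Y : C)
    (f : I → pts X → pts Y) : Prop :=
  ∀ (Z : C) (k : pts Z → pts X), (∀ i, IsMor Z Y (f i ∘ k)) → IsMor Z X k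

/-- A convex subset of `ℝⁿ` as a Chen space. -/
noncomputable abbrev ChenSpace.convexSet {n : ℕ} (A : Set (Euc n)) : ChenSpace.{u} :=
  ChenSpace.induced (fun x : ULift.{u} A => (x.down : Euc n))

theorem ChenSpace.isPlot_up {n : ℕ} {A : Set (Euc n)} (hA : Convex ℝ A) :
    (ChenSpace.convexSet.{u} A).IsPlot A ULift.up :=
  ⟨hA, id, contDiffOn_id, fun _ => rfl⟩

/-- The points of `ℝⁿ` all of whose coordinates lie in a given set. -/
def cube (n : ℕ) (A : Set ℝ) : Set (Euc n) :=
  {y | ∀ i, y i ∈ A}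

theorem convex_cube (n : ℕ) {A : Set ℝ} (hA : A.OrdConnected) : Convex ℝ (cube n A) :=
  fun _ hx _ hy _ _ ha hb hab i => hA.convex (hx i) (hy i) ha hb hab

theorem isOpen_cube (n : ℕ) {A : Set ℝ} (hA : IsOpen A) : IsOpen (cube n A) := by
  simp only [cube, Set.ofPred_forall]
  exact isOpen_iInter_of_finite fun i => hA.preimage (contDiff_apply_euc i).continuous

section Chart

variable {G : ChenSpace.{u}} {a : G.carrier → ULift.{u} ℝ}
  {A : Set ℝ} {X : ChenSpace.{u}} {n : ℕ} {π : Fin n → X.carrier → G.carrier}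
  {b : cube n A → X.carrier}

/-- Let a map `a` embed `G` in the real line, and let maps to `X` be tuples of maps to `G`.  Then
the inverse of the resulting embedding of `X` in `ℝⁿ` is a plot. -/
theorem ChenSpace.isPlot_inverse_chart (ha : ReflectsMor G ChenSpace.real fun _ : Unit => a)
    (hA : A.OrdConnected) (hπ : ReflectsMor X G π)
    (hb : ∀ y i, (a (π i (b y))).down = y.1 i) : X.IsPlot (cube n A) b := by
  have h : IsMor (ChenSpace.convexSet.{u} (cube n A)) X fun y => b y.down :=
    hπ _ _ fun i => ha _ _ fun _ =>
      ChenSpace.isMor_induced (contDiff_apply_euc i) fun y => hb y.down i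
  exact ChenSpace.isMor_iff.1 h _ _ (ChenSpace.isPlot_up (convex_cube n hA))

/-- Let `X` be embedded as an open convex subset of `ℝⁿ`.  Then a map that preserves plots with open
domain preserves morphisms from `X`: all plots of `X` factor through one with open domain. -/
theorem ChenSpace.isMor_of_open_plots (ha : ReflectsMor G ChenSpace.real fun _ : Unit => a)
    (ha' : IsMor G ChenSpace.real a) (hA : A.OrdConnected)
    (hAr : ∀ g, (a g).down ∈ A) (hAo : IsOpen A) (hπ : ReflectsMor X G π)
    (hπ' : ∀ i, IsMor X G (π i)) (hb : ∀ y i, (a (π i (b y))).down = y.1 i)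
    (hb' : ∀ x (h : WithLp.toLp 2 (fun i => (a (π i x)).down) ∈ cube n A), b ⟨_, h⟩ = x)
    {Y Z : ChenSpace.{u}} {q : X.carrier → Y.carrier} {f : Y.carrier → Z.carrier}
    (hq : IsMor X Y q)
    (hf : ∀ (U : Set (Euc n)), IsOpen U → ∀ ψ : U → Y.carrier, Y.IsPlot U ψ → Z.IsPlot U (f ∘ ψ)) :
    IsMor X Z (f ∘ q) := by
  have hqb : Z.IsPlot (cube n A) (f ∘ q ∘ b) := hf _ (isOpen_cube n hAo) _
    (ChenSpace.isMor_iff.1 hq _ _ (ChenSpace.isPlot_inverse_chart ha hA hπ hb))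
  refine ChenSpace.isMor_iff.2 fun C φ hφ => ?_
  have hs (i : Fin n) : SmoothAlong C fun x => (a (π i (φ x))).down :=
    (ChenSpace.isMor_iff.1 ha' C _ (ChenSpace.isMor_iff.1 (hπ' i) C φ hφ)).2
  convert ChenSpace.isPlot_factor hqb (X.convex_of_isPlot hφ)
    (h := fun x => WithLp.toLp 2 fun i => (a (π i (φ x))).down) (smoothAlong_pi hs)
    (fun x i => hAr _) using 1
  funext x
  exact congrArg (f ∘ q) (hb' (φ x) fun i => hAr _).symm

/-- The range of an embedding in the real line is an interval if any two points are joined by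
a curve. -/
theorem ChenSpace.ordConnected_range (ha : IsMor G ChenSpace.real a)
    (hG : ∀ g g', ∃ c, IsMor ChenSpace.real G c ∧ ∃ s t, c s = g ∧ c t = g') :
    (Set.range fun g => (a g).down).OrdConnected := by
  refine IsPreconnected.ordConnected (isPreconnected_of_forall_pair ?_)
  rintro _ ⟨g, rfl⟩ _ ⟨g', rfl⟩
  obtain ⟨c, hc, s, t, rfl, rfl⟩ := hG g g'
  have h := (ChenSpace.contDiff_of_isMor_real (ha.comp hc)).continuous
  refine ⟨Set.range fun r => (a (c ⟨r⟩)).down, ?_, ⟨s.down, rfl⟩, ⟨t.down, rfl⟩,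
    isPreconnected_range h⟩
  rintro _ ⟨r, rfl⟩
  exact ⟨_, rfl⟩

/-- An interval embedded in the real line, with endomorphisms that are bijective and act
transitively, has no endpoints: removing an endpoint leaves an interval, and an endomorphism would
carry this to an interval with an interior point removed. -/
theorem ChenSpace.isOpen_range (ha : ReflectsMor G ChenSpace.real fun _ : Unit => a)
    (ha' : IsMor G ChenSpace.real a) (hinj : Function.Injective a)
    (hA : (Set.range fun g => (a g).down).OrdConnected)
    (hne : ∃ g g' : G.carrier, g ≠ g')
    (hG : ∀ g g' : G.carrier, ∃ σ, IsMor G G σ ∧ Function.Bijective σ ∧ σ g = g') :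
    IsOpen (Set.range fun g => (a g).down) := by
  set A := Set.range fun g => (a g).down with hAdef
  obtain ⟨y, l, r, hlA, hrA, hly, hyr⟩ : ∃ y l r, l ∈ A ∧ r ∈ A ∧ l < y ∧ y < r := by
    obtain ⟨g, g', hgg⟩ := hne
    have h : (a g).down ≠ (a g').down := fun h => hgg (hinj (ULift.down_injective h))
    rcases lt_or_gt_of_ne h with h | h
    · obtain ⟨y, h1, h2⟩ := exists_between h
      exact ⟨y, _, _, ⟨g, rfl⟩, ⟨g', rfl⟩, h1, h2⟩
    · obtain ⟨y, h1, h2⟩ := exists_between h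
      exact ⟨y, _, _, ⟨g', rfl⟩, ⟨g, rfl⟩, h1, h2⟩
  obtain ⟨gy, rfl⟩ : y ∈ A := hA.out hlA hrA ⟨hly.le, hyr.le⟩
  refine isOpen_iff_mem_nhds.2 ?_
  rintro _ ⟨m, rfl⟩
  obtain ⟨σ, ⟨σ', rfl⟩, hbij, hσm⟩ := hG m gy
  -- the map induced by `σ` on the range
  have hchoice (y : cube 1 A) : ∃ g, (a g).down = y.1 0 := y.2 0
  choose b hb using hchoice
  have hbp : G.IsPlot (cube 1 A) b :=
    ChenSpace.isPlot_inverse_chart (π := fun _ => id) ha hA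
      (fun Z k h => h 0) fun y i => by
        rw [Subsingleton.elim i 0]
        exact hb y
  obtain ⟨-, H, hH, hHb⟩ := ChenSpace.isMor_iff.1 ha' _ _ (σ'.2 _ _ hbp)
  have hHa (g : G.carrier) : H (toEuc (a g).down) = (a (toMap σ' g)).down := by
    have h := hHb ⟨toEuc (a g).down, fun _ => ⟨g, rfl⟩⟩
    have h2 : b ⟨toEuc (a g).down, fun _ => ⟨g, rfl⟩⟩ = g :=
      hinj (ULift.down_injective (hb _))
    exact h.trans (congrArg (fun x => (a (toMap σ' x)).down) h2)
  have hcont : ContinuousOn (H ∘ toEuc) A :=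
    hH.continuousOn.comp contDiff_toEuc.continuous.continuousOn fun t ht _ => ht
  have hnot : ¬(A \ {(a m).down}).OrdConnected := by
    intro hoc
    have h1 := (hoc.isPreconnected.image _ (hcont.mono Set.sdiff_subset)).ordConnected
    have h2 (t : ℝ) (htA : t ∈ A) (ht : t ≠ (a gy).down) :
        t ∈ H ∘ toEuc '' (A \ {(a m).down}) := by
      obtain ⟨g, rfl⟩ := htA
      obtain ⟨g, rfl⟩ := hbij.2 g
      refine ⟨(a g).down, ⟨⟨g, rfl⟩, fun h => ht ?_⟩, hHa g⟩
      rw [hinj (ULift.down_injective h), hσm]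
    obtain ⟨_, ⟨⟨g, rfl⟩, hg⟩, h3⟩ := h1.out (h2 _ hlA hly.ne) (h2 _ hrA hyr.ne') ⟨hly.le, hyr.le⟩
    have h4 : (a (toMap σ' g)).down = (a gy).down := (hHa g).symm.trans h3
    have h5 := hinj (ULift.down_injective h4)
    rw [← hσm] at h5
    exact hg (congrArg (fun x => (a x).down) (hbij.1 h5))
  rw [Set.ordConnected_iff] at hnot
  push Not at hnot
  obtain ⟨x, hx, z, hz, -, hxz⟩ := hnot
  obtain ⟨w, hw, hwA⟩ := Set.not_subset.1 hxz
  have hwm : w = (a m).down := by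
    by_contra h
    exact hwA ⟨hA.out hx.1 hz.1 hw, h⟩
  subst hwm
  refine Filter.mem_of_superset (Icc_mem_nhds ?_ ?_) (hA.out hx.1 hz.1)
  · exact lt_of_le_of_ne hw.1 hx.2
  · exact lt_of_le_of_ne hw.2 (Ne.symm hz.2)

end Chart

/-! ### Chen spaces and Souriau spaces -/

/-- Morphisms of Souriau spaces can be tested on plots that are defined on the whole of `ℝⁿ`. -/
theorem SouriauSpace.isMor_of_euc {X Y : SouriauSpace.{u}} {f : X.carrier → Y.carrier}
    (h : ∀ n (q : ULift.{u} (Euc n) → X.carrier), IsMor (SouriauSpace.euc n) X q →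
      IsMor (SouriauSpace.euc n) Y (f ∘ q)) : IsMor X Y f := by
  refine SouriauSpace.isMor_iff.2 fun {n} U φ hφ => ?_
  have hU := X.isOpen_of_isPlot hφ
  refine Y.isPlot_of_local hU fun x hx => ?_
  obtain ⟨r, hr, hrU⟩ := Metric.isOpen_iff.1 hU x hx
  let χ : ContDiffBump x := ⟨r / 4, r / 2, by positivity, by linarith⟩
  -- a smooth map from the whole space to the ball that is the identity near the centre
  let θ : Euc n → Euc n := fun y => x + χ y • (y - x)
  have hθ : ContDiff ℝ ∞ θ := contDiff_const.add (χ.contDiff.smul (contDiff_id.sub contDiff_const))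
  have hθU (y : Euc n) : θ y ∈ U := by
    apply hrU
    rw [Metric.mem_ball, dist_eq_norm, add_sub_cancel_left, norm_smul, Real.norm_of_nonneg χ.nonneg]
    by_cases hy : dist y x < r / 2
    · rw [dist_eq_norm] at hy
      nlinarith [χ.le_one (x := y), χ.nonneg (x := y), norm_nonneg (y - x)]
    · rw [χ.zero_of_le_dist (not_lt.1 hy), zero_mul]
      exact hr
  have hθx (y : Euc n) (hy : y ∈ Metric.ball x (r / 4)) : θ y = y := by
    simp only [θ]
    rw [χ.one_of_mem_closedBall (Metric.ball_subset_closedBall hy), one_smul, add_sub_cancel]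
  have hq : IsMor (SouriauSpace.euc n) X fun y => φ ⟨θ y.down, hθU y.down⟩ :=
    SouriauSpace.isMor_iff.2 fun _ _ hψ =>
      SouriauSpace.isPlot_factor hφ hψ.1 (hψ.2.contDiff_comp hθ) fun _ => hθU _
  have hV : Metric.ball x (r / 4) ⊆ U := fun y hy => hθx y hy ▸ hθU y
  refine ⟨Metric.ball x (r / 4), hV, Metric.mem_ball_self (by positivity), Metric.isOpen_ball, ?_⟩
  convert SouriauSpace.isMor_iff.1 (h n _ hq) (Metric.ball x (r / 4)) (fun y => ⟨y⟩)
    ⟨Metric.isOpen_ball, id, contDiffOn_id, fun _ => rfl⟩ using 1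
  funext y
  simp only [Function.comp_apply]
  congr 2
  exact Subtype.ext (hθx y y.2).symm

theorem SouriauSpace.isMor_coord {n : ℕ} (i : Fin n) :
    IsMor (SouriauSpace.euc.{u} n) SouriauSpace.real
      fun x : ULift.{u} (Euc n) => (⟨x.down i⟩ : ULift.{u} ℝ) :=
  SouriauSpace.isMor_induced (contDiff_apply_euc i) fun _ => rfl

theorem SouriauSpace.reflectsMor_coord (n : ℕ) :
    ReflectsMor (SouriauSpace.euc.{u} n) SouriauSpace.real
      fun (i : Fin n) (x : ULift.{u} (Euc n)) => (⟨x.down i⟩ : ULift.{u} ℝ) := fun Z _ hk =>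
  SouriauSpace.isMor_iff.2 fun _ _ hφ => ⟨Z.isOpen_of_isPlot hφ,
    smoothAlong_pi fun i => (SouriauSpace.isMor_iff.1 (hk i) _ _ hφ).2⟩

theorem SouriauSpace.reflectsMor_of_deriv_ne_zero {f : ℝ → ℝ} (hf : ContDiff ℝ ∞ f)
    (hf' : ∀ x, deriv f x ≠ 0) :
    ReflectsMor SouriauSpace.real.{u} SouriauSpace.real
      fun (_ : Unit) (x : ULift.{u} ℝ) => (⟨f x.down⟩ : ULift.{u} ℝ) := fun Z _ hk =>
  SouriauSpace.isMor_iff.2 fun _ _ hφ => ⟨Z.isOpen_of_isPlot hφ,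
    smoothAlong_of_comp hf hf' (SouriauSpace.isMor_iff.1 (hk ()) _ _ hφ).2⟩

theorem conj_cancel {α α' γ γ' : Type*} (b : α ≃ α') (c : γ ≃ γ') (f : α' → γ') :
    c ∘ (c.symm ∘ f ∘ b) ∘ b.symm = f := by
  funext x
  simp

theorem PointCategory.ReflectsMor.transfer {C : Type (u + 1)} [Category.{u} C] [PointCategory C]
    {D : Type (u + 1)} [Category.{u} D] [PointCategory D]
    {R : ∀ (X : C) (Y : D), (pts X ≃ pts Y) → Prop} (hC : ∀ X, ∃ Y β, R X Y β)
    (hR : ∀ {X Y β X' Y' β'}, R X Y β → R X' Y' β' → ∀ f : pts X → pts X',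
      IsMor X X' f ↔ IsMor Y Y' (β' ∘ f ∘ β.symm))
    {X Y : C} {X' Y' : D} {β : pts X ≃ pts X'} {γ : pts Y ≃ pts Y'} (hX : R X X' β)
    (hY : R Y Y' γ) {I : Type} {f : I → pts X' → pts Y'} (hf : ReflectsMor X' Y' f) :
    ReflectsMor X Y fun i => γ.symm ∘ f i ∘ β := by
  intro Z k hk
  obtain ⟨Z', ζ, hZ⟩ := hC Z
  refine (hR hZ hX k).2 (hf _ _ fun i => ?_)
  convert (hR hZ hY _).1 (hk i) using 1
  funext z
  simp

/-- Suppose a bijection of the points of a Chen space `G` with the reals carries the morphisms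
from `G` to itself to the smooth functions, and that functions with nonvanishing derivative
reflect morphisms into `G`.  Then `G` embeds in the Chen space of reals as an open interval: curves
and smooth functions on `G` combine to a nonconstant morphism `e` from `G` to itself that factors
through the real line; as `e` is an embedding somewhere, so is its first factor. -/
theorem ChenSpace.exists_embedding {G : ChenSpace.{u}} (β : G.carrier ≃ ULift.{u} ℝ)
    (hsmooth : ∀ f : G.carrier → G.carrier, IsMor G G f →
      ContDiff ℝ ∞ fun t => (β (f (β.symm ⟨t⟩))).down)
    (hmor : ∀ h : ℝ → ℝ, ContDiff ℝ ∞ h → IsMor G G fun g => β.symm ⟨h (β g).down⟩)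
    (hrefl : ∀ h : ℝ → ℝ, ContDiff ℝ ∞ h → (∀ x, deriv h x ≠ 0) →
      ReflectsMor G G fun _ : Unit => fun g => β.symm ⟨h (β g).down⟩)
    {p : ULift.{u} ℝ → G.carrier} (hp : IsMor ChenSpace.real G p) (hp' : ∃ s t, p s ≠ p t)
    {v : G.carrier → ULift.{u} ℝ} (hv : IsMor G ChenSpace.real v) (hv' : ∃ g g', v g ≠ v g') :
    ∃ a : G.carrier → ULift.{u} ℝ, IsMor G ChenSpace.real a ∧
      (ReflectsMor G ChenSpace.real fun _ : Unit => a) ∧ Function.Injective a ∧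
      (Set.range fun g => (a g).down).OrdConnected ∧ IsOpen (Set.range fun g => (a g).down) := by
  obtain ⟨s, t, hst⟩ := hp'
  obtain ⟨g, g', hgg⟩ := hv'
  have hβ (x y : G.carrier) (h : x ≠ y) : (β x).down ≠ (β y).down :=
    fun h' => h (β.injective (ULift.down_injective h'))
  have hβs (x : G.carrier) : β.symm ⟨(β x).down⟩ = x := β.symm_apply_apply x
  -- the affine function taking the values of `v` at `g` and `g'` to `s` and `t`
  have hvd : (v g').down - (v g).down ≠ 0 :=
    sub_ne_zero.2 fun h => hgg (ULift.down_injective h.symm)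
  let l : ℝ → ℝ := fun r =>
    s.down + (r - (v g).down) / ((v g').down - (v g).down) * (t.down - s.down)
  have hl : ContDiff ℝ ∞ l := by fun_prop
  have hlg : l (v g).down = s.down := by simp [l]
  have hlg' : l (v g').down = t.down := by simp [l, div_self hvd]
  let w : G.carrier → ULift.{u} ℝ := fun x => ⟨l (v x).down⟩
  have hw : IsMor G ChenSpace.real w :=
    IsMor.comp (X := G) (Y := ChenSpace.real) (Z := ChenSpace.real)
      (g := fun x : ULift.{u} ℝ => (⟨l x.down⟩ : ULift.{u} ℝ))
      (ChenSpace.isMor_induced hl fun _ => rfl) hv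
  let e : ℝ → ℝ := fun r => (β (p (w (β.symm ⟨r⟩)))).down
  have he : ContDiff ℝ ∞ e := hsmooth _ (hp.comp hw)
  have hne : e (β g).down ≠ e (β g').down := by
    have h1 : w g = s := ULift.down_injective hlg
    have h2 : w g' = t := ULift.down_injective hlg'
    simp only [e, ULift.up_down, Equiv.symm_apply_apply, h1, h2]
    exact hβ _ _ hst
  obtain ⟨j, hj, hej⟩ := exists_comp_deriv_ne_zero he hne
  let a : G.carrier → ULift.{u} ℝ := fun x => w (β.symm ⟨j (β x).down⟩)
  have ha : IsMor G ChenSpace.real a := hw.comp (hmor j hj)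
  have hpa (x : G.carrier) : p (a x) = β.symm ⟨(e ∘ j) (β x).down⟩ :=
    (hβs _).symm
  have haR : ReflectsMor G ChenSpace.real fun _ : Unit => a := by
    intro Z k hk
    refine hrefl (e ∘ j) (he.comp hj) hej Z k fun _ => ?_
    convert hp.comp (hk ()) using 1
    exact funext fun z => (hpa (k z)).symm
  have hinj : Function.Injective a := by
    intro x y hxy
    have h := congrArg p hxy
    rw [hpa, hpa] at h
    have h2 := injective_of_deriv_ne_zero ((he.comp hj).differentiable (by simp)) hej
      (congrArg ULift.down (β.symm.injective h))
    exact β.injective (ULift.down_injective h2)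
  have hord := ChenSpace.ordConnected_range ha fun x y => by
    -- an affine function moves any two points of the curve `p` to `x` and `y`
    have hd : (β (p t)).down - (β (p s)).down ≠ 0 := sub_ne_zero.2 (hβ _ _ hst).symm
    refine ⟨_, IsMor.comp (hmor (fun r => (β x).down + (r - (β (p s)).down) /
      ((β (p t)).down - (β (p s)).down) * ((β y).down - (β x).down)) (by fun_prop)) hp,
      s, t, ?_, ?_⟩
    · change β.symm ⟨(β x).down + ((β (p s)).down - (β (p s)).down) / _ * _⟩ = x
      rw [sub_self, zero_div, zero_mul, add_zero, hβs]
    · change β.symm ⟨(β x).down + ((β (p t)).down - (β (p s)).down) / _ * _⟩ = y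
      rw [div_self hd, one_mul, add_sub_cancel, hβs]
  refine ⟨a, ha, haR, hinj, hord, ChenSpace.isOpen_range haR ha hinj hord
    ⟨g, g', fun h => hgg (congrArg v h)⟩ fun x y => ?_⟩
  refine ⟨_, hmor (fun r => r + ((β y).down - (β x).down)) (by fun_prop), ?_, ?_⟩
  swap
  · change β.symm ⟨(β x).down + ((β y).down - (β x).down)⟩ = y
    rw [add_sub_cancel, hβs]
  constructor
  · intro z z' h
    have h2 := congrArg ULift.down (β.symm.injective h)
    exact β.injective (ULift.down_injective (add_right_cancel h2))
  · intro z
    refine ⟨β.symm ⟨(β z).down - ((β y).down - (β x).down)⟩, ?_⟩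
    simp only [Equiv.apply_symm_apply, sub_add_cancel]
    exact hβs z

theorem isEmpty_equivalence_chen_souriau : IsEmpty (ChenSpace.{u} ≌ SouriauSpace.{u}) := by
  refine ⟨fun E => ?_⟩
  obtain ⟨R, hC, hD, hR⟩ := exists_correspondence E
  obtain ⟨G, (β : G.carrier ≃ ULift.{u} ℝ), hG⟩ := hD SouriauSpace.real
  obtain ⟨H, (γ : ULift.{u} ℝ ≃ H.carrier), hH⟩ := hC ChenSpace.real
  have hsmooth (f : G.carrier → G.carrier) (hf : IsMor G G f) :
      ContDiff ℝ ∞ fun t => (β (f (β.symm ⟨t⟩))).down :=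
    SouriauSpace.contDiff_of_isMor_real ((hR hG hG f).1 hf)
  have hmor (h : ℝ → ℝ) (hh : ContDiff ℝ ∞ h) : IsMor G G fun g => β.symm ⟨h (β g).down⟩ := by
    refine (hR hG hG _).2 (SouriauSpace.isMor_induced hh fun x => ?_)
    change (β (β.symm ⟨h (β (β.symm x)).down⟩)).down = h x.down
    rw [β.apply_symm_apply, β.apply_symm_apply]
  have hrefl (h : ℝ → ℝ) (hh : ContDiff ℝ ∞ h) (hh' : ∀ x, deriv h x ≠ 0) :
      ReflectsMor G G fun _ : Unit => fun g => β.symm ⟨h (β g).down⟩ :=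
    ReflectsMor.transfer hC hR hG hG (SouriauSpace.reflectsMor_of_deriv_ne_zero hh hh')
  -- `G` and `H` are not discrete, hence have nonconstant curves
  obtain ⟨p, hp, hp'⟩ : ∃ p, IsMor ChenSpace.real G p ∧ ∃ s t, p s ≠ p t := by
    by_contra! h
    refine not_contDiff_abs ?_
    simpa using hsmooth _ (ChenSpace.isMor_of_curves_const h G fun x => β.symm ⟨|(β x).down|⟩)
  obtain ⟨v, hv, g, g', hgg⟩ : ∃ v, IsMor SouriauSpace.real H v ∧ ∃ s t, v s ≠ v t := by
    by_contra! h
    refine not_contDiff_abs ?_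
    let f : ULift.{u} ℝ → ULift.{u} ℝ := fun x => ⟨|x.down|⟩
    exact ChenSpace.contDiff_of_isMor_real (f := f)
      ((hR hH hH f).2 (SouriauSpace.isMor_of_curves_const h H _))
  obtain ⟨a, ha, haR, hinj, hord, hopen⟩ :=
    ChenSpace.exists_embedding β hsmooth hmor hrefl hp hp' (v := γ.symm ∘ v ∘ β)
      ((hR hG hH _).2 ((conj_cancel β γ v).symm ▸ hv))
      ⟨β.symm g, β.symm g', fun h => hgg <|
        (congrArg v (β.apply_symm_apply g)).symm.trans
          ((γ.symm.injective h).trans (congrArg v (β.apply_symm_apply g')))⟩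
  obtain ⟨W, (η : ULift.{u} NNReal ≃ W.carrier), hW⟩ := hC ChenSpace.halfLine
  obtain ⟨Z, (ζ : ULift.{u} NNReal ≃ Z.carrier), hZ⟩ := hC ChenSpace.flatHalfLine
  refine ChenSpace.not_isMor_flatHalfLine ((hR hW hZ id).2 ?_)
  refine SouriauSpace.isMor_of_euc fun n q hq => ?_
  obtain ⟨X, (δ : X.carrier ≃ ULift.{u} (Euc n)), hX⟩ := hD (SouriauSpace.euc n)
  let π (i : Fin n) (x : X.carrier) : G.carrier := β.symm ⟨(δ x).down i⟩
  have hπ (i : Fin n) : IsMor X G (π i) :=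
    by
    have h := conj_cancel δ β fun x : ULift.{u} (Euc n) => (⟨x.down i⟩ : ULift.{u} ℝ)
    exact (hR hX hG (π i)).2 (h.symm ▸ SouriauSpace.isMor_coord i)
  have hπR : ReflectsMor X G π :=
    ReflectsMor.transfer hC hR hX hG (SouriauSpace.reflectsMor_coord n)
  let A := Set.range fun g => (a g).down
  have hinv (y : cube n A) (i : Fin n) : ∃ g, (a g).down = y.1 i := y.2 i
  choose c hc using hinv
  let b (y : cube n A) : X.carrier := δ.symm ⟨WithLp.toLp 2 fun i => (β (c y i)).down⟩
  have hπb (y : cube n A) (i : Fin n) : π i (b y) = c y i := by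
    simp only [π, b, δ.apply_symm_apply]
    exact β.symm_apply_apply _
  have hq' : IsMor X ChenSpace.halfLine (η.symm ∘ q ∘ δ) :=
    (hR hX hW _).2 ((conj_cancel δ η q).symm ▸ hq)
  have h := ChenSpace.isMor_of_open_plots (Y := ChenSpace.halfLine)
    (Z := ChenSpace.flatHalfLine) (f := id) haR ha hord
    (fun g => ⟨g, rfl⟩) hopen hπR hπ (b := b) (fun y i => (hπb y i).symm ▸ hc y i)
    (fun x hx => by
      have h1 (i : Fin n) : c ⟨_, hx⟩ i = π i x := hinj (ULift.down_injective (hc ⟨_, hx⟩ i))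
      simp only [b, h1, π, β.apply_symm_apply]
      exact δ.symm_apply_apply x) hq'
    (fun U hU ψ hψ => ChenSpace.isPlot_flatHalfLine_of_isOpen hU hψ)
  have heq : ζ ∘ (id ∘ η.symm ∘ q ∘ δ) ∘ δ.symm = (ζ ∘ id ∘ η.symm) ∘ q :=
    funext fun x => congrArg (ζ ∘ η.symm ∘ q) (δ.apply_symm_apply x)
  exact heq ▸ (hR hX hZ _).1 h

end SmoothSpaces

theorem mainTheorem1 :
    (IsEmpty (SmoothSpaces.ChenSpace.{u} ≌ SmoothSpaces.SouriauSpace.{u}) ∧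
      IsEmpty (SmoothSpaces.ChenSpace.{u} ≌ SmoothSpaces.FrolicherSpace.{u}) ∧
      IsEmpty (SmoothSpaces.SouriauSpace.{u} ≌ SmoothSpaces.FrolicherSpace.{u})) ∧
    (IsEmpty (SmoothSpaces.SikorskiSpace.{u} ≌ SmoothSpaces.SmithSpace.{u}) ∧
      IsEmpty (SmoothSpaces.SikorskiSpace.{u} ≌ SmoothSpaces.FrolicherSpace.{u}) ∧
      IsEmpty (SmoothSpaces.SmithSpace.{u} ≌ SmoothSpaces.FrolicherSpace.{u})) :=
  ⟨⟨SmoothSpaces.isEmpty_equivalence_chen_souriau,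
    SmoothSpaces.isEmpty_equivalence_frolicher (SmoothSpaces.ChenSpace.ofTop (ULift.{u} Prop))
      (Equiv.refl _) SmoothSpaces.ChenSpace.not_isMor_swapProp,
    SmoothSpaces.isEmpty_equivalence_frolicher (SmoothSpaces.SouriauSpace.ofTop (ULift.{u} Prop))
      (Equiv.refl _) SmoothSpaces.SouriauSpace.not_isMor_swapProp⟩,
    SmoothSpaces.isEmpty_equivalence_sikorski_smith,
    SmoothSpaces.isEmpty_equivalence_frolicher (SmoothSpaces.SikorskiSpace.ofTop (ULift.{u} Prop))
      (Equiv.refl _) SmoothSpaces.SikorskiSpace.not_isMor_swapProp,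
    SmoothSpaces.isEmpty_equivalence_frolicher (SmoothSpaces.SmithSpace.ofTop (ULift.{u} Prop))
      (Equiv.refl _) SmoothSpaces.SmithSpace.not_isMor_swapProp⟩
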